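/- There are absolute constants $b, C$ such that the following holds for all integers $n, k \ge 1$ with $k \le (\log_2 n)/2$. In the Congested Clique model with $n$ nodes (the nodes are the vertices of an unknown simple graph $G$ on $\{0,\dots,n-1\}$; each node initially knows $n$, $k$, its own identifier and its set of neighbours in $G$; in each synchronous round every node may send to every other node a message of at most $b\lceil\log_2 n\rceil = O(\log n)$ bits, and local computation is unlimited), there is a deterministic algorithm that, on every such graph $G$, after at most $C k^2 = O(k^2)$ rounds, has every node output correctly whether or not $G$ contains a simple cycle of length $2k$ (a copy of $C_{2k}$, not necessarily induced). In particular, for constant $k$, $C_{2k}$-detection takes $O(1)$ rounds. -/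

import Mathlib

namespace CongestedClique

/-- A message of exactly `B` bits. -/
abbrev Message (B : ℕ) : Type := Fin B → Bool

/-- A deterministic algorithm with Boolean outputs for the Congested Clique on the `n` nodes
`Fin n`, with `B` bits per message. Local computation is unlimited, so the local functions are
arbitrary. A node starts from its own identifier and its own neighbourhood in the input graph; in
each synchronous round it sends one message to every node (its state may contain its identifier),
and then updates its state from the messages it received. -/
structure Algorithm (n B : ℕ) where
  /-- The local states. -/
  State : Type
  /-- The initial state of a node, from its identifier and the set of its neighbours. -/
  init : Fin n → Set (Fin n) → State
  /-- `send s u` is the message that a node in state `s` sends to node `u`. -/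
  send : State → Fin n → Message B
  /-- `receive s m` is the new state of a node in state `s` that receives `m u` from each `u`. -/
  receive : State → (Fin n → Message B) → State
  /-- The answer of a node whose final state is given. -/
  output : State → Bool

namespace Algorithm

variable {n B : ℕ}

/-- The state of each node after a number of rounds, on the input graph `G`. -/
def stateAfter (A : Algorithm n B) (G : SimpleGraph (Fin n)) : ℕ → Fin n → A.State
  | 0, v => A.init v (G.neighborSet v)
  | t + 1, v => A.receive (A.stateAfter G t v) fun u => A.send (A.stateAfter G t u) v

/-- After `T` rounds, on every input graph, every node outputs whether the graph has property
`P`. -/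
def DecidesIn (A : Algorithm n B) (P : SimpleGraph (Fin n) → Prop) (T : ℕ) : Prop :=
  ∀ (G : SimpleGraph (Fin n)) (v : Fin n), A.output (A.stateAfter G T v) = true ↔ P G

end Algorithm

/-- The graph `G` contains a (simple) cycle of length `ℓ`. -/
def HasCycleOfLength {V : Type*} (G : SimpleGraph V) (ℓ : ℕ) : Prop :=
  ∃ (v : V) (w : G.Walk v v), w.IsCycle ∧ w.length = ℓ

end CongestedClique

/-! A graph with more than about k·n^(1+1/k) edges contains C_{2k}
(`hasCycleOfLength_of_card_edges`), so only sparse graphs need a search. Put ℓ = 2k and let s be the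
integer part of n^(1/ℓ). A sparse graph then has at most M = n·s²·R directed edges with R = O(k),
and the s^ℓ sequences of ℓ block numbers go to distinct nodes.

A sequence selects sets X_0, …, X_{ℓ-1}. Each is one of s blocks of nodes, and X_{i+1} comes from a
cut that balances at once the degrees, the degrees into X_i and the degrees into X_0 (`part`). So
X_i has degree sum O(M/s), and two cyclically consecutive sets span only O(kn) edges
(`sum_degIn_part_succ_le`). The blocks of a cut cover all nodes, so every ℓ-cycle runs along some
sequence (`exists_mem_part`), whose node sees it once it knows those edges.

Collecting the edges costs O(k) rounds for each of the ℓ pairs of places (`attains_knowsPair`). The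
s² sequences that differ only at the two places form a team. The edges are dealt evenly to its
members, who pass each edge to the one member, if any, that needs it; nobody sends or receives more
than O(kn) edges (`Attains.route`).

Since local computation is unlimited, an algorithm is described only by the inputs that its nodes
can tell apart (`Attains`). -/

open Finset

/-! ### Algorithms described by what nodes can distinguish -/

namespace CongestedClique

variable {n B T : ℕ}

/-- Some algorithm has, after `T` rounds, a state from which each node `v` can tell its identifier
and tell apart any two input graphs that are not related by `κ v`. -/
def Attains (n B T : ℕ) (κ : Fin n → SimpleGraph (Fin n) → SimpleGraph (Fin n) → Prop) : Prop :=
  ∃ A : Algorithm n B, ∀ G G' v v', A.stateAfter G T v = A.stateAfter G' T v' → v = v' ∧ κ v G G'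

theorem Attains.start (n B : ℕ) :
    Attains n B 0 fun v G G' => G.neighborSet v = G'.neighborSet v := by
  refine ⟨⟨Fin n × Set (Fin n), fun v N => (v, N), fun _ _ _ => false, fun s _ => s,
    fun _ => false⟩, fun G G' v v' h => ?_⟩
  simp only [Algorithm.stateAfter, Prod.mk.injEq] at h
  obtain ⟨rfl, h⟩ := h
  exact ⟨rfl, h⟩

theorem Attains.mono {κ κ' : Fin n → SimpleGraph (Fin n) → SimpleGraph (Fin n) → Prop}
    (h : Attains n B T κ) (hκ : ∀ v G G', κ v G G' → κ' v G G') : Attains n B T κ' := by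
  obtain ⟨A, hA⟩ := h
  exact ⟨A, fun G G' v v' e => ⟨(hA G G' v v' e).1, hκ _ _ _ (hA G G' v v' e).2⟩⟩

theorem Attains.round {κ : Fin n → SimpleGraph (Fin n) → SimpleGraph (Fin n) → Prop}
    (h : Attains n B T κ) (m : SimpleGraph (Fin n) → Fin n → Fin n → Message B)
    (hm : ∀ u G G', κ u G G' → m G u = m G' u) :
    Attains n B (T + 1) fun v G G' => κ v G G' ∧ ∀ u, m G u v = m G' u v := by
  classical
  obtain ⟨A, hA⟩ := h
  have hsnd : ∃ snd : A.State → Fin n → Message B, ∀ G u, snd (A.stateAfter G T u) = m G u := by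
    -- The message is computed from any graph and node that produce the state; `hm` makes the choice
    -- immaterial.
    refine ⟨fun st => if h : ∃ p : SimpleGraph (Fin n) × Fin n, A.stateAfter p.1 T p.2 = st then
      m h.choose.1 h.choose.2 else fun _ _ => false, fun G u => ?_⟩
    have h : ∃ p : SimpleGraph (Fin n) × Fin n, A.stateAfter p.1 T p.2 = A.stateAfter G T u :=
      ⟨(G, u), rfl⟩
    obtain ⟨h1, h2⟩ := hA _ _ _ _ h.choose_spec
    simp only [dif_pos h]
    exact (hm _ _ _ h2).trans (congrArg _ h1)
  obtain ⟨snd, hsnd⟩ := hsnd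
  -- The round counter lets `A` run unchanged for `T` rounds; the last component stores the messages
  -- of the extra round.
  let A' : Algorithm n B :=
    { State := ℕ × A.State × (Fin n → Message B)
      init := fun v N => (0, A.init v N, fun _ _ => false)
      send := fun st u => if st.1 = T then snd st.2.1 u else A.send st.2.1 u
      receive := fun st r =>
        if st.1 = T then (st.1 + 1, st.2.1, r) else (st.1 + 1, A.receive st.2.1 r, st.2.2)
      output := fun _ => false }
  have key : ∀ t ≤ T, ∀ G v, A'.stateAfter G t v = (t, A.stateAfter G t v, fun _ _ => false) := by
    intro t
    induction t with
    | zero => intro _ G v; rfl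
    | succ t ih =>
      intro ht G v
      have ht' : t ≠ T := by omega
      simp only [Algorithm.stateAfter, ih (by omega)]
      simp [A', ht']
  have last : ∀ G v, A'.stateAfter G (T + 1) v =
      (T + 1, A.stateAfter G T v, fun u => m G u v) := by
    intro G v
    simp only [Algorithm.stateAfter, key T le_rfl]
    simp [A', hsnd]
  refine ⟨A', fun G G' v v' e => ?_⟩
  have e := ((last G v).symm.trans e).trans (last G' v')
  rw [Prod.mk.injEq, Prod.mk.injEq] at e
  replace e := e.2
  obtain ⟨rfl, h2⟩ := hA _ _ _ _ e.1
  exact ⟨rfl, h2, fun u => congrFun e.2 u⟩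

theorem Attains.exchange {M : Type*} {κ : Fin n → SimpleGraph (Fin n) → SimpleGraph (Fin n) → Prop}
    (h : Attains n B T κ) (S : Set M) (hfin : S.Finite) (hS : S.ncard ≤ 2 ^ B)
    (m : SimpleGraph (Fin n) → Fin n → Fin n → M) (hmS : ∀ G u v, m G u v ∈ S)
    (hm : ∀ u G G', κ u G G' → m G u = m G' u) :
    Attains n B (T + 1) fun v G G' => κ v G G' ∧ ∀ u, m G u v = m G' u v := by
  classical
  have : Finite S := hfin
  have := Fintype.ofFinite S
  obtain ⟨enc⟩ : Nonempty (S ↪ Message B) := by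
    apply Function.Embedding.nonempty_of_card_le
    rw [← Nat.card_eq_fintype_card, Nat.card_coe_set_eq]
    simpa using hS
  refine (h.round (fun G u v => enc ⟨m G u v, hmS G u v⟩) fun u G G' hκ => ?_).mono
    fun v G G' hκ => ⟨hκ.1, fun u => ?_⟩
  · funext v
    have := congrFun (hm u G G' hκ) v
    simp only [this]
  · simpa using hκ.2 u

/-- The set `s` if it has exactly one element, and the empty set otherwise. -/
def onlyElement {E : Type*} (s : Set E) : Set E := {x | s = {x}}

theorem onlyElement_of_subsingleton {E : Type*} {s : Set E} (hs : s.Subsingleton) :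
    onlyElement s = s := by
  ext x
  refine ⟨fun h => ?_, fun h => hs.eq_singleton_of_mem h⟩
  rw [show s = {x} from h]
  rfl

theorem onlyElement_subsingleton {E : Type*} (s : Set E) : (onlyElement s).Subsingleton :=
  fun _ hx _ hy => Set.singleton_injective ((Eq.symm hx).trans hy)

/-- Exchange of sets with at most one element, in `R` rounds; larger sets are not transmitted. -/
theorem Attains.exchangeSets {E : Type*} [Finite E]
    {κ : Fin n → SimpleGraph (Fin n) → SimpleGraph (Fin n) → Prop}
    (h : Attains n B T κ) (hE : Nat.card E + 1 ≤ 2 ^ B) (R : ℕ)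
    (m : ℕ → SimpleGraph (Fin n) → Fin n → Fin n → Set E)
    (hm : ∀ u G G', κ u G G' → ∀ j < R, m j G u = m j G' u) :
    Attains n B (T + R) fun v G G' => κ v G G' ∧
      ∀ j < R, ∀ u, onlyElement (m j G u v) = onlyElement (m j G' u v) := by
  induction R with
  | zero => exact h.mono fun v G G' hκ => ⟨hκ, by simp⟩
  | succ R ih =>
    have hcard : {s : Set E | s.Subsingleton}.ncard ≤ 2 ^ B := by
      refine le_trans ?_ hE
      have hsub : {s : Set E | s.Subsingleton} ⊆ Set.range (fun o : Option E => {x | o = some x}) := by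
        intro s hs
        rcases Set.Subsingleton.eq_empty_or_singleton hs with rfl | ⟨x, rfl⟩
        · exact ⟨none, by simp⟩
        · exact ⟨some x, by ext y; simp [eq_comm]⟩
      refine (Set.ncard_le_ncard hsub (Set.toFinite _)).trans ?_
      rw [← Finite.card_option, ← Set.image_univ, ← Set.ncard_univ]
      exact Set.ncard_image_le
    refine ((ih fun u G G' hκ j hj => hm u G G' hκ j (by omega)).exchange _ (Set.toFinite _) hcard
      (fun G u v => onlyElement (m R G u v)) (fun G u v => onlyElement_subsingleton _)
      (fun u G G' hκ => ?_)).mono fun v G G' hκ => ⟨hκ.1.1, fun j hj u => ?_⟩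
    · simp only [hm u G G' hκ.1 R (by omega)]
    · rcases Nat.lt_succ_iff_lt_or_eq.mp hj with hj | rfl
      · exact hκ.1.2 j hj u
      · exact hκ.2 u

theorem Attains.decides {κ : Fin n → SimpleGraph (Fin n) → SimpleGraph (Fin n) → Prop}
    (h : Attains n B T κ) (P : SimpleGraph (Fin n) → Prop)
    (hP : ∀ v G G', κ v G G' → P G → P G') : ∃ A : Algorithm n B, A.DecidesIn P T := by
  classical
  obtain ⟨A, hA⟩ := h
  -- A node accepts when some input compatible with its state has the property; by `hP` all
  -- compatible inputs then have it.
  let A' : Algorithm n B :=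
    { A with output := fun st => decide (∃ G v, A.stateAfter G T v = st ∧ P G) }
  have key : ∀ G t v, A'.stateAfter G t v = A.stateAfter G t v := by
    intro G t
    induction t with
    | zero => intro v; rfl
    | succ t ih => intro v; simp only [Algorithm.stateAfter, ih]; rfl
  refine ⟨A', fun G v => ?_⟩
  rw [key]
  simp only [A', decide_eq_true_eq]
  constructor
  · rintro ⟨G', v', e, hG'⟩
    obtain ⟨rfl, hκ⟩ := hA _ _ _ _ e
    exact hP _ _ _ hκ hG'
  · exact fun hG => ⟨G, v, rfl, hG⟩

end CongestedClique

/-! ### Even cycles in dense graphs -/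

namespace CongestedClique

section EvenCycles

variable {V : Type*}

-- Deleting a vertex of degree at most `d` lowers the degree sum by at most `2 * d`, so the
-- inequality survives until no such vertex is left.
open Classical in
theorem exists_subset_lt_card_neighbors [Fintype V] (H : SimpleGraph V) (d : ℕ) (S : Finset V)
    (h : 2 * d * #S < ∑ v ∈ S, #{w ∈ S | H.Adj v w}) :
    ∃ T ⊆ S, T.Nonempty ∧ ∀ v ∈ T, d < #{w ∈ T | H.Adj v w} := by
  induction S using Finset.strongInduction with
  | H S ih =>
    by_cases hS : ∀ v ∈ S, d < #{w ∈ S | H.Adj v w}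
    · refine ⟨S, Subset.rfl, ?_, hS⟩
      rw [nonempty_iff_ne_empty]
      rintro rfl
      simp at h
    · push Not at hS
      obtain ⟨v, hv, hd⟩ := hS
      have hcard : #(S.erase v) + 1 = #S := card_erase_add_one hv
      have h1 : ∀ u, #{w ∈ S | H.Adj u w} =
          #{w ∈ S.erase v | H.Adj u w} + if H.Adj u v then 1 else 0 := by
        intro u
        rw [filter_erase]
        split_ifs with huv
        · rw [card_erase_add_one (by simp [hv, huv])]
        · rw [erase_eq_of_notMem (by simp [huv])]; rfl
      have h2 : ∑ u ∈ S, #{w ∈ S | H.Adj u w} =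
          #{w ∈ S | H.Adj v w} + (∑ u ∈ S.erase v, #{w ∈ S.erase v | H.Adj u w} +
            #{w ∈ S | H.Adj v w}) := by
        rw [← add_sum_erase _ _ hv, sum_congr rfl fun u _ => h1 u, sum_add_distrib, ← card_filter]
        congr 3
        ext u
        simp only [mem_filter, mem_erase, H.adj_comm u v]
        exact ⟨fun h => ⟨h.1.2, h.2⟩, fun h => ⟨⟨h.2.ne', h.1⟩, h.2⟩⟩
      obtain ⟨T, hT, h'⟩ := ih (S.erase v) (erase_ssubset hv) (by nlinarith)
      exact ⟨T, hT.trans (erase_subset _ _), h'⟩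

open Classical in
theorem exists_path_avoiding (H : SimpleGraph V) {d : ℕ} {T : Finset V}
    (hT : ∀ v ∈ T, d < #{w ∈ T | H.Adj v w}) (j : ℕ) (F : Finset V) (z : V) (hz : z ∈ T)
    (hzF : z ∉ F) (hj : #F + j ≤ d) :
    ∃ (y : V) (P : H.Walk z y), P.IsPath ∧ P.length = j ∧ ∀ u ∈ P.support, u ∈ T ∧ u ∉ F := by
  induction j generalizing F z with
  | zero => exact ⟨z, .nil, by simp, by simp, by simp [hz, hzF]⟩
  | succ j ih =>
    obtain ⟨u, hu, huF⟩ : ∃ u ∈ ({w ∈ T | H.Adj z w} : Finset V), u ∉ F := by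
      apply exists_mem_notMem_of_card_lt_card
      have := hT z hz
      omega
    rw [mem_filter] at hu
    obtain ⟨y, P, hP, hl, hs⟩ := ih (insert z F) u hu.1 (by simp [huF, hu.2.ne'])
      (by have := card_insert_le z F; omega)
    refine ⟨y, .cons hu.2 P, hP.cons fun h => by simpa using (hs z h).2, by simp [hl], ?_⟩
    simp only [SimpleGraph.Walk.support_cons, List.mem_cons, forall_eq_or_imp]
    exact ⟨⟨hz, hzF⟩, fun v hv => ⟨(hs v hv).1, fun h => (hs v hv).2 (mem_insert_of_mem h)⟩⟩

/-- `p` maps each vertex at a positive finite level to a neighbour one level lower. -/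
def IsParentMap (G : SimpleGraph V) (L : V → ℕ∞) (p : V → V) : Prop :=
  ∀ v (i : ℕ), L v = (i + 1 : ℕ) → G.Adj v (p v) ∧ L (p v) = i

variable {G : SimpleGraph V} {L : V → ℕ∞} {p : V → V}

theorem IsParentMap.level_iterate (hp : IsParentMap G L p) {v : V} {i j : ℕ} (hv : L v = i)
    (hj : j ≤ i) : L (p^[j] v) = (i - j : ℕ) := by
  induction j generalizing v i with
  | zero => simpa using hv
  | succ j ih =>
    obtain ⟨i, rfl⟩ : ∃ i', i = i' + 1 := ⟨i - 1, by omega⟩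
    rw [Function.iterate_succ_apply, ih (hp v i hv).2 (by omega)]
    congr 1
    omega

theorem IsParentMap.exists_path (hp : IsParentMap G L p) {v : V} {i h : ℕ} (hv : L v = i)
    (hh : h ≤ i) : ∃ P : G.Walk v (p^[h] v), P.IsPath ∧ P.length = h ∧
      ∀ u ∈ P.support, ∃ j ≤ h, u = p^[j] v := by
  induction h generalizing v i with
  | zero => exact ⟨.nil, by simp, by simp, by simp⟩
  | succ h ih =>
    obtain ⟨i, rfl⟩ : ∃ i', i = i' + 1 := ⟨i - 1, by omega⟩
    obtain ⟨hadj, hl⟩ := hp v i hv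
    obtain ⟨P, hP, hlen, hs⟩ := ih hl (by omega)
    rw [Function.iterate_succ_apply]
    refine ⟨.cons hadj P, hP.cons fun hm => ?_, by simp [hlen], fun u hu => ?_⟩
    · obtain ⟨j, hj, e⟩ := hs v hm
      have := hp.level_iterate hl (j := j) (by omega)
      rw [← e, hv, Nat.cast_inj] at this
      omega
    · rw [SimpleGraph.Walk.support_cons, List.mem_cons] at hu
      obtain rfl | hu := hu
      · exact ⟨0, by omega, rfl⟩
      · obtain ⟨j, hj, e⟩ := hs u hu
        exact ⟨j + 1, by omega, e⟩

/-- The tree paths from `a` and `w` cannot meet before their last vertex: common vertices have equal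
levels, and an earlier meeting would identify the `h`-th ancestors. Past their starting points they
lie below level `i`, while `Q` stays at level `i` or above, so the union is a simple cycle. -/
theorem IsParentMap.hasCycleOfLength (hp : IsParentMap G L p) {a w : V} {i h ℓ : ℕ} (ha : L a = i)
    (hw : L w = i) (hh : h + 1 ≤ i) (hne : p^[h] a ≠ p^[h] w)
    (heq : p^[h + 1] a = p^[h + 1] w) (Q : G.Walk w a) (hQ : Q.IsPath)
    (hlen : Q.length + 2 * (h + 1) = ℓ) (hQL : ∀ u ∈ Q.support, (i : ℕ∞) ≤ L u) :
    HasCycleOfLength G ℓ := by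
  obtain ⟨r, hr⟩ : ∃ r, p^[h + 1] a = r := ⟨_, rfl⟩
  obtain ⟨A, hA, hAl, hAs⟩ : ∃ A : G.Walk a r, A.IsPath ∧ A.length = h + 1 ∧
      ∀ u ∈ A.support, ∃ j ≤ h + 1, u = p^[j] a := hr ▸ hp.exists_path ha hh
  obtain ⟨W, hW, hWl, hWs⟩ : ∃ W : G.Walk w r, W.IsPath ∧ W.length = h + 1 ∧
      ∀ u ∈ W.support, ∃ j ≤ h + 1, u = p^[j] w := (heq.symm.trans hr) ▸ hp.exists_path hw hh
  have lvl : ∀ u, (i : ℕ∞) ≤ L u → ∀ v, L v = i → ∀ j ≤ h + 1, u = p^[j] v → u = v := by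
    intro u hu v hv j hj e
    have := hp.level_iterate hv (j := j) (by omega)
    rw [← e] at this
    rw [this, Nat.cast_le] at hu
    obtain rfl : j = 0 := by omega
    exact e
  have hP : (A.append W.reverse).IsPath := by
    rw [SimpleGraph.Walk.isPath_def, SimpleGraph.Walk.support_append, List.nodup_append']
    refine ⟨hA.support_nodup, hW.reverse.support_nodup.tail, fun u hu1 hu2 => ?_⟩
    obtain ⟨j, hj, e⟩ := hAs u hu1
    obtain ⟨j', hj', e'⟩ := hWs u (by simpa using List.mem_of_mem_tail hu2)
    have h1 := hp.level_iterate ha (j := j) (by omega)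
    have h2 := hp.level_iterate hw (j := j') (by omega)
    rw [← e] at h1
    rw [← e', h1, Nat.cast_inj] at h2
    obtain rfl : j = j' := by omega
    by_cases hjh : j = h + 1
    · subst hjh
      have hnd := hW.reverse.support_nodup
      rw [← SimpleGraph.Walk.cons_tail_support, List.nodup_cons] at hnd
      exact hnd.1 ((e.trans hr) ▸ hu2)
    · apply hne
      have : h = (h - j) + j := by omega
      rw [this, Function.iterate_add_apply, Function.iterate_add_apply, ← e, ← e']
  refine ⟨a, (A.append W.reverse).append Q, hP.isCycle_append hQ (fun u hu1 hu2 => ?_)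
    (Or.inl ?_), ?_⟩
  · have hL := hQL u (List.mem_of_mem_tail hu2)
    have hu : u ∈ A.support ∨ u ∈ W.reverse.support :=
      (SimpleGraph.Walk.mem_support_append_iff _ _).1 (List.mem_of_mem_tail hu1)
    rcases hu with hu | hu
    · obtain ⟨j, hj, e⟩ := hAs u hu
      obtain rfl := lvl u hL a ha j hj e
      have hnd := hP.support_nodup
      rw [← SimpleGraph.Walk.cons_tail_support, List.nodup_cons] at hnd
      exact hnd.1 hu1
    · obtain ⟨j, hj, e⟩ := hWs u (by simpa using hu)
      obtain rfl := lvl u hL w hw j hj e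
      have hnd := hQ.support_nodup
      rw [← SimpleGraph.Walk.cons_tail_support, List.nodup_cons] at hnd
      exact hnd.1 hu2
  · simp [hAl, hWl]; omega
  · simp [hAl, hWl]; omega

/-- Two successive `Z`-vertices of the walk share the `Y`-vertex between them, so the common value
of `f` on neighbours propagates along the walk. `Y` and `Z` may coincide. -/
theorem odd_walk_invariant {α : Type*} {H : SimpleGraph V} {T : Finset V} {Y Z : V → Prop}
    (f : V → α) (hYZ : ∀ u ∈ T, ∀ v ∈ T, H.Adj u v → Y u → Z v)
    (hZY : ∀ u ∈ T, ∀ v ∈ T, H.Adj u v → Z u → Y v)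
    (hf : ∀ z ∈ T, Z z → ∀ a ∈ T, ∀ b ∈ T, H.Adj z a → H.Adj z b → f a = f b) (m : ℕ) :
    ∀ {z y : V} (P : H.Walk z y), (∀ u ∈ P.support, u ∈ T) → P.length = 2 * m + 1 → Z z →
      Y y ∧ ∀ a ∈ T, H.Adj z a → f a = f y := by
  induction m with
  | zero =>
    intro z y P hP hl hz
    cases P with
    | nil => simp at hl
    | cons e P =>
      cases P with
      | nil =>
        simp only [SimpleGraph.Walk.support_cons, SimpleGraph.Walk.support_nil, List.mem_cons,
          List.not_mem_nil, or_false, forall_eq_or_imp, forall_eq] at hP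
        exact ⟨hZY _ hP.1 _ hP.2 e hz, fun a ha haz => hf _ hP.1 hz _ ha _ hP.2 haz e⟩
      | cons e P => simp at hl
  | succ m ih =>
    intro z y P hP hl hz
    cases P with
    | nil => simp at hl
    | cons e P =>
      cases P with
      | nil => simp at hl
      | cons e' P =>
        rename_i u1 u2
        simp only [SimpleGraph.Walk.support_cons, List.mem_cons, forall_eq_or_imp] at hP
        simp only [SimpleGraph.Walk.length_cons] at hl
        have h2 : u2 ∈ T := hP.2.2 _ P.start_mem_support
        obtain ⟨hy, hy'⟩ := ih P hP.2.2 (by omega)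
          (hYZ _ hP.2.1 _ h2 e' (hZY _ hP.1 _ hP.2.1 e hz))
        exact ⟨hy, fun a ha haz =>
          (hf _ hP.1 hz _ ha _ hP.2.1 haz e).trans (hy' _ hP.2.1 e'.symm)⟩

open Classical in
theorem IsParentMap.hasCycleOfLength_of_dense (hp : IsParentMap G L p)
    (hroot : ∀ u v, L u = 0 → L v = 0 → u = v) {H : SimpleGraph V} (hH : H ≤ G) {T : Finset V}
    {Y Z : V → Prop} {i k : ℕ} (hik : i < k)
    (hT : ∀ v ∈ T, 2 * k + 1 < #{w ∈ T | H.Adj v w}) (hTL : ∀ v ∈ T, (i : ℕ∞) ≤ L v)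
    (hYL : ∀ v, Y v → L v = i)
    (hYZ : ∀ u ∈ T, ∀ v ∈ T, H.Adj u v → Y u → Z v)
    (hZY : ∀ u ∈ T, ∀ v ∈ T, H.Adj u v → Z u → Y v) (hZ : ∃ z ∈ T, Z z) :
    HasCycleOfLength G (2 * k) := by
  -- The least such `h` is positive, and one generation earlier some `z` has neighbours `a`, `b`
  -- with different ancestors.
  let Pr : ℕ → Prop := fun h =>
    ∀ z ∈ T, Z z → ∀ a ∈ T, ∀ b ∈ T, H.Adj z a → H.Adj z b → p^[h] a = p^[h] b
  have hPr : Pr i := by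
    intro z hz hzZ a ha b hb haz hbz
    have h1 := hp.level_iterate (hYL _ (hZY _ hz _ ha haz hzZ)) le_rfl
    have h2 := hp.level_iterate (hYL _ (hZY _ hz _ hb hbz hzZ)) le_rfl
    exact hroot _ _ (by simpa using h1) (by simpa using h2)
  have hex : ∃ h, Pr h := ⟨i, hPr⟩
  have hi : Nat.find hex ≤ i := Nat.find_min' hex hPr
  have hspec := Nat.find_spec hex
  have hmin : ∀ m < Nat.find hex, ¬ Pr m := fun m hm => Nat.find_min hex hm
  generalize Nat.find hex = h at hi hspec hmin
  have h0 : h ≠ 0 := by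
    rintro rfl
    obtain ⟨z, hz, hzZ⟩ := hZ
    obtain ⟨a, ha, b, hb, hab⟩ := one_lt_card.1 (show 1 < #{w ∈ T | H.Adj z w} by
      have := hT z hz; omega)
    rw [mem_filter] at ha hb
    exact hab (hspec z hz hzZ a ha.1 b hb.1 ha.2 hb.2)
  obtain ⟨h, rfl⟩ : ∃ h', h = h' + 1 := ⟨h - 1, by omega⟩
  have hn := hmin h (by omega)
  simp only [Pr, not_forall] at hn
  obtain ⟨z, hz, hzZ, a, ha, b, hb, haz, hbz, hab⟩ := hn
  -- An edge at `z`, a path of length `2 * m + 1` and two tree paths of length `h + 1` add up to `2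
  -- * k`.
  obtain ⟨m, hm⟩ : ∃ m, k = h + 1 + (m + 1) := ⟨k - (h + 1) - 1, by omega⟩
  obtain ⟨y, P, hP, hPl, hPs⟩ := exists_path_avoiding H hT (2 * m + 1) {a, b} z hz
    (by simp [haz.ne, hbz.ne]) (by have := card_le_two (a := a) (b := b); omega)
  obtain ⟨hy, hy'⟩ := odd_walk_invariant (p^[h + 1]) hYZ hZY hspec m P (fun u hu => (hPs u hu).1)
    hPl hzZ
  have key : ∀ c ∈ T, H.Adj z c → c ∉ P.support → p^[h] c ≠ p^[h] y →
      HasCycleOfLength G (2 * k) := by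
    intro c hc hcz hcP hne
    refine hp.hasCycleOfLength (hYL _ (hZY _ hz _ hc hcz hzZ)) (hYL _ hy) hi hne (hy' c hc hcz)
      ((P.cons hcz.symm).reverse.mapLe hH) ?_ ?_ ?_
    · exact (SimpleGraph.Walk.isPath_mapLe hH).2 (hP.cons hcP).reverse
    · simp [hPl]; omega
    · intro u hu
      simp only [SimpleGraph.Walk.support_mapLe_eq_support, SimpleGraph.Walk.support_reverse,
        SimpleGraph.Walk.support_cons, List.mem_reverse, List.mem_cons] at hu
      rcases hu with rfl | hu
      · exact hTL _ hc
      · exact hTL _ (hPs u hu).1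
  -- The `h`-th ancestor of `y` differs from that of `a` or from that of `b`; that neighbour closes
  -- the cycle.
  by_cases hya : p^[h] a = p^[h] y
  · refine key b hb hbz (fun hs => by simpa using (hPs b hs).2) fun hyb => hab (hya.trans hyb.symm)
  · exact key a ha haz (fun hs => by simpa using (hPs a hs).2) hya

open Classical in
/-- **Bondy–Simonovits** for even cycles, in a form with a minimum degree condition. -/
theorem hasCycleOfLength_of_minDegree [Fintype V] (G : SimpleGraph V) {k q : ℕ} (hq : 1 ≤ q)
    (hqk : Fintype.card V < q ^ k) {T : Finset V} (hTne : T.Nonempty)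
    (hT : ∀ v ∈ T, (2 * k + 1) * (5 + q) < #{w ∈ T | G.Adj v w}) :
    HasCycleOfLength G (2 * k) := by
  by_contra hno
  obtain ⟨x, hx⟩ := hTne
  obtain ⟨G', hadj⟩ : ∃ G' : SimpleGraph V, ∀ u v, G'.Adj u v ↔ G.Adj u v ∧ u ∈ T ∧ v ∈ T :=
    ⟨{ Adj := fun u v => G.Adj u v ∧ u ∈ T ∧ v ∈ T
       symm := ⟨fun u v h => ⟨h.1.symm, h.2.2, h.2.1⟩⟩
       loopless := ⟨fun u h => h.1.ne rfl⟩ }, fun _ _ => Iff.rfl⟩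
  have hG' : G' ≤ G := fun u v h => ((hadj u v).1 h).1
  have hno' : ¬ HasCycleOfLength G' (2 * k) := by
    rintro ⟨v, w, hw, hl⟩
    exact hno ⟨v, w.mapLe hG', hw.mapLe hG', by simpa using hl⟩
  let L : V → ℕ∞ := fun v => G'.edist x v
  have hstep : ∀ u v, G'.Adj u v → L v ≤ L u + 1 := fun u v h =>
    (SimpleGraph.edist_triangle (v := u)).trans
      (by rw [SimpleGraph.edist_eq_one_iff_adj.2 h])
  have hpar : ∀ v, ∃ u, ∀ i : ℕ, L v = (i + 1 : ℕ) → G'.Adj v u ∧ L u = i := by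
    intro v
    by_cases hv : ∃ i : ℕ, L v = (i + 1 : ℕ)
    · obtain ⟨i, hi⟩ := hv
      obtain ⟨w, hw⟩ := SimpleGraph.exists_walk_of_edist_eq_coe
        (show G'.edist v x = (i + 1 : ℕ) by rw [SimpleGraph.edist_comm]; exact hi)
      cases w with
      | nil => simp at hw
      | cons e w =>
        rename_i u
        refine ⟨u, fun j hj => ⟨e, ?_⟩⟩
        obtain rfl : i = j := by
          have := hi.symm.trans hj
          rw [Nat.cast_inj] at this
          omega
        apply le_antisymm
        · have := SimpleGraph.edist_le w
          rw [SimpleGraph.edist_comm] at this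
          simp only [SimpleGraph.Walk.length_cons, Nat.add_right_cancel_iff] at hw
          rwa [hw] at this
        · have := hstep u v e.symm
          rw [hi] at this
          push_cast at this
          exact (ENat.add_le_add_iff_right (by simp)).1 this
    · push Not at hv
      exact ⟨v, fun i hi => absurd hi (hv i)⟩
  choose p hp using hpar
  have hp : IsParentMap G' L p := hp
  have hroot : ∀ u v, L u = 0 → L v = 0 → u = v := by
    intro u v hu hv
    rw [SimpleGraph.edist_eq_zero_iff] at hu hv
    exact hu.symm.trans hv
  obtain ⟨S, hS⟩ : ∃ S : ℕ → Finset V, ∀ i v, v ∈ S i ↔ L v = i :=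
    ⟨fun i => {v | L v = i}, by simp⟩
  have hST : ∀ i, ∀ v ∈ S i, v ∈ T := by
    intro i v hv
    rw [hS] at hv
    cases i with
    | zero => exact hroot x v (by simp [L]) (by simpa using hv) ▸ hx
    | succ i => exact ((hadj _ _).1 (hp v i hv).1).2.1
  have hdisj : ∀ i j, i ≠ j → Disjoint (S i) (S j) := by
    intro i j hij
    rw [disjoint_left]
    intro v hv hv'
    rw [hS] at hv hv'
    exact hij (by exact_mod_cast hv.symm.trans hv')
  -- A level with too many inner edges has a subset of large minimum degree, hence a cycle; here `Y`
  -- and `Z` are the same level.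
  have hin : ∀ i < k, ∑ v ∈ S i, #{w ∈ S i | G'.Adj v w} ≤ 2 * (2 * k + 1) * #(S i) := by
    intro i hik
    by_contra hlt
    obtain ⟨T', hT'S, ⟨z, hz⟩, hT'⟩ := exists_subset_lt_card_neighbors G' _ _ (not_le.1 hlt)
    have hlev : ∀ v ∈ T', L v = i := fun v hv => (hS i v).1 (hT'S hv)
    exact hno' (hp.hasCycleOfLength_of_dense hroot le_rfl (Y := fun v => L v = i)
      (Z := fun v => L v = i) hik hT' (fun v hv => (hlev v hv).ge) (fun _ h => h)
      (fun _ _ v hv _ _ => hlev v hv) (fun _ _ v hv _ _ => hlev v hv) ⟨z, hz, hlev z hz⟩)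
  have hbet : ∀ i < k, ∑ v ∈ S i, #{w ∈ S (i + 1) | G'.Adj v w} ≤
      (2 * k + 1) * (#(S i) + #(S (i + 1))) := by
    intro i hik
    by_contra hlt
    rw [not_le] at hlt
    -- Keeping only the edges between the two levels makes `H` bipartite with sides `Y` and `Z`.
    obtain ⟨H, hH⟩ : ∃ H : SimpleGraph V, ∀ u v, H.Adj u v ↔
        G'.Adj u v ∧ (L u = i ∧ L v = (i + 1 : ℕ) ∨ L u = (i + 1 : ℕ) ∧ L v = i) :=
      ⟨{ Adj := fun u v =>
          G'.Adj u v ∧ (L u = i ∧ L v = (i + 1 : ℕ) ∨ L u = (i + 1 : ℕ) ∧ L v = i)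
         symm := ⟨fun u v h => ⟨h.1.symm, h.2.symm.imp And.symm And.symm⟩⟩
         loopless := ⟨fun u h => h.1.ne rfl⟩ }, fun _ _ => Iff.rfl⟩
    have hne : ((i : ℕ) : ℕ∞) ≠ (i + 1 : ℕ) := by
      rw [Ne, Nat.cast_inj]; omega
    have hd : Disjoint (S i) (S (i + 1)) := hdisj _ _ (by omega)
    have hsum : 2 * (2 * k + 1) * #(S i ∪ S (i + 1)) <
        ∑ v ∈ S i ∪ S (i + 1), #{w ∈ S i ∪ S (i + 1) | H.Adj v w} := by
      rw [sum_union hd, card_union_of_disjoint hd]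
      have h1 : ∑ v ∈ S i, #{w ∈ S (i + 1) | G'.Adj v w} ≤
          ∑ v ∈ S i, #{w ∈ S i ∪ S (i + 1) | H.Adj v w} := by
        refine sum_le_sum fun v hv => card_le_card fun w hw => ?_
        rw [mem_filter, hS] at hw
        rw [mem_filter, mem_union, hS (i + 1), hH]
        exact ⟨Or.inr hw.1, hw.2, Or.inl ⟨(hS _ _).1 hv, hw.1⟩⟩
      have h2 : ∑ v ∈ S i, #{w ∈ S (i + 1) | G'.Adj v w} ≤
          ∑ v ∈ S (i + 1), #{w ∈ S i ∪ S (i + 1) | H.Adj v w} := by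
        have := sum_card_bipartiteAbove_eq_sum_card_bipartiteBelow (s := S i) (t := S (i + 1))
          (fun v w => G'.Adj v w)
        simp only [bipartiteAbove, bipartiteBelow] at this
        rw [this]
        refine sum_le_sum fun v hv => card_le_card fun w hw => ?_
        rw [mem_filter, hS] at hw
        rw [mem_filter, mem_union, hS i, hH]
        exact ⟨Or.inl hw.1, hw.2.symm, Or.inr ⟨(hS _ _).1 hv, hw.1⟩⟩
      nlinarith
    obtain ⟨T', hT'S, ⟨z, hz⟩, hT'⟩ := exists_subset_lt_card_neighbors H _ _ hsum
    refine hno' (hp.hasCycleOfLength_of_dense hroot (H := H) (fun u v h => ((hH u v).1 h).1)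
      (Y := fun v => L v = i) (Z := fun v => L v = (i + 1 : ℕ)) hik hT' (fun v hv => ?_)
      (fun _ h => h) ?_ ?_ ?_)
    · have := hT'S hv
      rw [mem_union, hS, hS] at this
      rcases this with h | h
      · exact h.ge
      · rw [h]; exact_mod_cast Nat.le_succ i
    · intro u _ v _ huv hu
      rcases ((hH _ _).1 huv).2 with h | h
      · exact h.2
      · exact absurd (hu.symm.trans h.1) hne
    · intro u _ v _ huv hu
      rcases ((hH _ _).1 huv).2 with h | h
      · exact absurd (h.1.symm.trans hu) hne
      · exact h.2
    · obtain ⟨y, hy⟩ := card_pos.1 (lt_of_le_of_lt (Nat.zero_le _) (hT' z hz))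
      rw [mem_filter] at hy
      rcases ((hH _ _).1 hy.2).2 with h | h
      · exact ⟨y, hy.1, h.2⟩
      · exact ⟨z, hz, h.1⟩
  have hcover : ∀ i, ∀ v ∈ S i, ∀ w, G'.Adj v w →
      w ∈ S i ∨ w ∈ S (i + 1) ∨ ∃ j, i = j + 1 ∧ w ∈ S j := by
    intro i v hv w hvw
    rw [hS] at hv
    have h1 := hstep v w hvw
    have h2 := hstep w v hvw.symm
    rw [hv] at h1 h2
    have hfin : L w ≠ ⊤ := ne_top_of_le_ne_top (by exact_mod_cast ENat.natCast_ne_top (i + 1)) h1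
    obtain ⟨m, hm⟩ := ENat.ne_top_iff_exists.1 hfin
    rw [← hm] at h1 h2
    norm_cast at h1 h2
    rw [hS, hS, ← hm]
    by_cases e : i = m + 1
    · exact Or.inr (Or.inr ⟨m, e, by rw [hS, hm]⟩)
    · rw [Nat.cast_inj, Nat.cast_inj]
      omega
  have hdeg : ∀ i, (2 * k + 1) * (5 + q) * #(S i) ≤ ∑ v ∈ S i, #{w | G'.Adj v w} := by
    intro i
    rw [mul_comm, ← smul_eq_mul]
    refine card_nsmul_le_sum _ _ _ fun v hv => (hT v (hST i v hv)).le.trans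
      (card_le_card fun w hw => ?_)
    rw [mem_filter] at hw
    simpa [hadj] using ⟨hw.2, hST i v hv, hw.1⟩
  -- In units of `2 * k + 1`, a vertex has average degree at least `5 + q`. Edges inside the level
  -- use 2, the two bounds between levels use 1 each, and the previous level, being no larger, uses
  -- 1; `q` is left for the next level.
  have hgrow : ∀ i < k, q * #(S i) ≤ #(S (i + 1)) := by
    intro i
    induction i with
    | zero =>
      intro hik
      have h1 : ∑ v ∈ S 0, #{w | G'.Adj v w} ≤ ∑ v ∈ S 0, #{w ∈ S 0 | G'.Adj v w} +
          ∑ v ∈ S 0, #{w ∈ S (0 + 1) | G'.Adj v w} := by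
        rw [← sum_add_distrib]
        refine sum_le_sum fun v hv => le_trans (card_le_card fun w hw => ?_) (card_union_le _ _)
        have hw : G'.Adj v w := by simpa using hw
        rw [mem_union, mem_filter, mem_filter]
        rcases hcover 0 v hv w hw with h | h | ⟨j, hj, -⟩
        · exact Or.inl ⟨h, hw⟩
        · exact Or.inr ⟨h, hw⟩
        · omega
      have := hdeg 0
      have := hin 0 hik
      have := hbet 0 hik
      have : (2 * k + 1) * (q * #(S 0)) ≤ (2 * k + 1) * #(S (0 + 1)) := by nlinarith
      exact Nat.le_of_mul_le_mul_left this (by omega)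
    | succ i ih =>
      intro hik
      have h1 : ∑ v ∈ S (i + 1), #{w | G'.Adj v w} ≤
          ∑ v ∈ S (i + 1), #{w ∈ S (i + 1) | G'.Adj v w} +
          ∑ v ∈ S (i + 1), #{w ∈ S (i + 1 + 1) | G'.Adj v w} +
          ∑ v ∈ S (i + 1), #{w ∈ S i | G'.Adj v w} := by
        rw [← sum_add_distrib, ← sum_add_distrib]
        refine sum_le_sum fun v hv => le_trans (card_le_card fun w hw => ?_)
          ((card_union_le _ _).trans (Nat.add_le_add_right (card_union_le _ _) _))
        have hw : G'.Adj v w := by simpa using hw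
        rw [mem_union, mem_union, mem_filter, mem_filter, mem_filter]
        rcases hcover (i + 1) v hv w hw with h | h | ⟨j, hj, h⟩
        · exact Or.inl (Or.inl ⟨h, hw⟩)
        · exact Or.inl (Or.inr ⟨h, hw⟩)
        · obtain rfl : i = j := by omega
          exact Or.inr ⟨h, hw⟩
      have h2 : ∑ v ∈ S (i + 1), #{w ∈ S i | G'.Adj v w} =
          ∑ v ∈ S i, #{w ∈ S (i + 1) | G'.Adj v w} := by
        have := sum_card_bipartiteAbove_eq_sum_card_bipartiteBelow (s := S (i + 1)) (t := S i)
          (fun v w => G'.Adj v w)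
        simp only [bipartiteAbove, bipartiteBelow] at this
        rw [this]
        simp only [G'.adj_comm]
      have h3 := hdeg (i + 1)
      have h4 := hin (i + 1) hik
      have h5 := hbet (i + 1) hik
      have h6 := hbet i (by omega)
      have h7 := ih (by omega)
      have h8 : #(S i) ≤ #(S (i + 1)) := le_trans (Nat.le_mul_of_pos_left _ hq) h7
      have h9 := Nat.mul_le_mul_left (2 * k + 1) h8
      have : (2 * k + 1) * (q * #(S (i + 1))) ≤ (2 * k + 1) * #(S (i + 1 + 1)) := by nlinarith
      exact Nat.le_of_mul_le_mul_left this (by omega)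
  have hpow : ∀ i ≤ k, q ^ i ≤ #(S i) := by
    intro i
    induction i with
    | zero =>
      intro _
      rw [pow_zero, Nat.one_le_iff_ne_zero, Ne, card_eq_zero]
      exact ne_empty_of_mem ((hS 0 x).2 (by simp [L]))
    | succ i ih =>
      intro hik
      rw [pow_succ']
      exact (Nat.mul_le_mul_left q (ih (by omega))).trans (hgrow i (by omega))
  exact absurd ((hpow k le_rfl).trans (card_le_univ _)) (not_le.2 hqk)

open Classical in
theorem hasCycleOfLength_of_card_edges [Fintype V] (G : SimpleGraph V) {k q : ℕ} (hq : 1 ≤ q)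
    (hqk : Fintype.card V < q ^ k)
    (hG : 2 * ((2 * k + 1) * (5 + q)) * Fintype.card V < ∑ v, #{w | G.Adj v w}) :
    HasCycleOfLength G (2 * k) := by
  obtain ⟨T, -, hTne, hT⟩ := exists_subset_lt_card_neighbors G _ univ (by simpa using hG)
  exact hasCycleOfLength_of_minDegree G hq hqk hTne hT

end EvenCycles

end CongestedClique

/-! ### Routing by edge colouring -/

namespace CongestedClique

open Classical in
theorem exists_greedy_coloring {E : Type*} (c : E → E → Prop) (hc : ∀ x y, c x y → c y x) (N : ℕ)
    (S : Finset E) (hS : ∀ x ∈ S, ∃ U : Finset E, (∀ y ∈ S, c x y → y ∈ U) ∧ #U < N) :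
    ∃ col : E → ℕ, (∀ x ∈ S, col x < N) ∧ ∀ x ∈ S, ∀ y ∈ S, c x y → col x = col y → x = y := by
  induction S using Finset.induction_on with
  | empty => exact ⟨fun _ => 0, by simp, by simp⟩
  | insert a S ha ih =>
    obtain ⟨col, h1, h2⟩ := ih fun x hx => by
      obtain ⟨U, hU, hUN⟩ := hS x (mem_insert_of_mem hx)
      exact ⟨U, fun y hy => hU y (mem_insert_of_mem hy), hUN⟩
    obtain ⟨U, hU, hUN⟩ := hS a (mem_insert_self a S)
    obtain ⟨t, ht, htn⟩ : ∃ t ∈ range N, t ∉ image col U := by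
      apply exists_mem_notMem_of_card_lt_card
      rw [card_range]
      exact card_image_le.trans_lt hUN
    have hne : ∀ x ∈ S, x ≠ a := fun x hx h => ha (h ▸ hx)
    have hcol : ∀ x ∈ S, c a x → col x ≠ t := fun x hx hcx h =>
      htn (mem_image.2 ⟨x, hU x (mem_insert_of_mem hx) hcx, h⟩)
    refine ⟨Function.update col a t, fun x hx => ?_, fun x hx y hy hxy => ?_⟩
    · rcases mem_insert.1 hx with rfl | hx
      · simpa using ht
      · simpa [hne x hx] using h1 x hx
    · intro hcol'
      rcases mem_insert.1 hx with hxa | hxS <;> rcases mem_insert.1 hy with hya | hyS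
      · rw [hxa, hya]
      · subst hxa
        rw [Function.update_self, Function.update_of_ne (hne y hyS)] at hcol'
        exact absurd hcol'.symm (hcol y hyS hxy)
      · subst hya
        rw [Function.update_self, Function.update_of_ne (hne x hxS)] at hcol'
        exact absurd hcol' (hcol x hxS (hc _ _ hxy))
      · rw [Function.update_of_ne (hne x hxS), Function.update_of_ne (hne y hyS)] at hcol'
        exact h2 x hxS y hyS hxy hcol'

/-- A colouring of the messages `(x, y, t)` from `x` to `y`, with `t < C x y`, in which messages
with a common source or a common target get different colours. -/
def IsMessageColoring {I : Type*} (C : I → I → ℕ) (N : ℕ) (col : I → I → ℕ → ℕ) : Prop :=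
  (∀ x y, ∀ t < C x y, col x y t < N) ∧
  (∀ x y y' t t', t < C x y → t' < C x y' → col x y t = col x y' t' → y = y' ∧ t = t') ∧
  ∀ x x' y t t', t < C x y → t' < C x' y → col x y t = col x' y t' → x = x' ∧ t = t'

/-- At most `N` messages share the source of a given one and at most `N` its target, so greedy
colouring succeeds. -/
theorem exists_isMessageColoring {I : Type*} [Fintype I] (C : I → I → ℕ) (N : ℕ)
    (hrow : ∀ x, ∑ y, C x y ≤ N) (hcol : ∀ y, ∑ x, C x y ≤ N) :
    ∃ col, IsMessageColoring C (2 * N + 1) col := by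
  classical
  let S : Finset (Σ _ : I × I, ℕ) := univ.sigma fun p => range (C p.1 p.2)
  have hmem : ∀ x y t, (⟨(x, y), t⟩ : Σ _ : I × I, ℕ) ∈ S ↔ t < C x y := by simp [S]
  obtain ⟨col, h1, h2⟩ := exists_greedy_coloring
    (fun a b : Σ _ : I × I, ℕ => a.1.1 = b.1.1 ∨ a.1.2 = b.1.2)
    (fun a b h => h.imp Eq.symm Eq.symm) (2 * N + 1) S (by
      rintro ⟨⟨x, y⟩, t⟩ -
      refine ⟨((univ.image fun y' => (x, y')).sigma fun p => range (C p.1 p.2)) ∪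
          ((univ.image fun x' => (x', y)).sigma fun p => range (C p.1 p.2)), ?_,
          Nat.lt_succ_of_le ((card_union_le _ _).trans ?_)⟩
      · rintro ⟨⟨x', y'⟩, t'⟩ hb hxy
        rw [hmem] at hb
        simp only [mem_union, mem_sigma, mem_image, mem_univ, true_and, Prod.mk.injEq, mem_range]
        obtain rfl | rfl := hxy
        · exact Or.inl ⟨⟨y', rfl, rfl⟩, hb⟩
        · exact Or.inr ⟨⟨x', rfl, rfl⟩, hb⟩
      rw [card_sigma, card_sigma, sum_image fun _ _ _ _ h => (Prod.ext_iff.1 h).2,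
        sum_image fun _ _ _ _ h => (Prod.ext_iff.1 h).1]
      simp only [card_range]
      have := hrow x
      have := hcol y
      omega)
  refine ⟨fun x y t => col ⟨(x, y), t⟩, fun x y t ht => h1 _ ((hmem _ _ _).2 ht),
    fun x y y' t t' ht ht' h => ?_, fun x x' y t t' ht ht' h => ?_⟩
  · simpa using h2 _ ((hmem _ _ _).2 ht) _ ((hmem _ _ _).2 ht') (Or.inl rfl) h
  · simpa using h2 _ ((hmem _ _ _).2 ht) _ ((hmem _ _ _).2 ht') (Or.inr rfl) h

/-- Nodes act as members of teams: `Q` is the set of members, `d v` the member that node `v` acts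
as, `e q` a node that acts as `q`. The members of a team are indexed by `I`, and `move q x` is the
member with index `x` of the team of `q`. -/
structure Teams (n : ℕ) (Q I : Type*) where
  e : Q → Fin n
  d : Fin n → Q
  d_e : ∀ q, d (e q) = q
  idx : Q → I
  move : Q → I → Q
  idx_move : ∀ q x, idx (move q x) = x
  move_idx : ∀ q, move q (idx q) = q
  move_move : ∀ q x y, move (move q x) y = move q y

variable {n B T : ℕ}

/-- Messages can be routed within all teams in parallel, each node sending and receiving at most
`N` of them; `P G q y` is the set of messages that `q` has for the member `y` of its team. -/
theorem Attains.route {Q I E : Type*} [Fintype I] [Finite E] (𝒯 : Teams n Q I)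
    (ρ : I × I → Fin n) (σ : Fin n → I × I) (hρ : ∀ p, σ (ρ p) = p)
    {κ : Fin n → SimpleGraph (Fin n) → SimpleGraph (Fin n) → Prop} (h : Attains n B T κ)
    (hE : Nat.card I * Nat.card E + 1 ≤ 2 ^ B) (P : SimpleGraph (Fin n) → Q → I → Finset E)
    (hP : ∀ v G G', κ v G G' → P G (𝒯.d v) = P G' (𝒯.d v)) (N R : ℕ) (hR : 2 * N + 1 ≤ n * R)
    (Good : SimpleGraph (Fin n) → Prop) (hrow : ∀ G, Good G → ∀ q, ∑ y, #(P G q y) ≤ N)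
    (hcol : ∀ G, Good G → ∀ q, ∑ x, #(P G (𝒯.move q x) (𝒯.idx q)) ≤ N) :
    Attains n B (T + 2 + 2 * R) fun v G G' => κ v G G' ∧ (Good G → Good G' → ∀ a,
      (∃ x, a ∈ P G (𝒯.move (𝒯.d v) x) (𝒯.idx (𝒯.d v))) ↔
      (∃ x, a ∈ P G' (𝒯.move (𝒯.d v) x) (𝒯.idx (𝒯.d v)))) := by
  classical
  rcases isEmpty_or_nonempty (Fin n) with hn | ⟨⟨v₀⟩⟩
  · exact ⟨⟨Unit, fun _ _ => (), fun _ _ _ => false, fun _ _ => (), fun _ => false⟩,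
      fun _ _ v => hn.elim v⟩
  have hn : 0 < n := v₀.pos
  have : Nonempty I := ⟨𝒯.idx (𝒯.d v₀)⟩
  have hE' : Nat.card E + 1 ≤ 2 ^ B := by
    have : 0 < Nat.card I := Nat.card_pos
    nlinarith
  have hcardE : ∀ G q y, #(P G q y) ≤ Nat.card E := fun G q y => by
    have := Fintype.ofFinite E
    rw [Nat.card_eq_fintype_card]
    exact card_le_univ _
  have hcnt : ((range (Nat.card E + 1) : Finset ℕ) : Set ℕ).ncard ≤ 2 ^ B := by
    rw [Set.ncard_coe_finset, card_range]
    exact hE'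
  -- The members of each team learn the sizes of all message sets in the team.
  have hA := (h.exchange _ (finite_toSet _) hcnt (fun G u r => #(P G (𝒯.d u) (σ r).2))
    (fun G u r => by
      rw [mem_coe, mem_range]
      exact Nat.lt_succ_of_le (hcardE _ _ _))
    fun u G G' hκ => by simp only [hP u G G' hκ]).exchange _ (finite_toSet _) hcnt
    -- Node `r` relays the single entry `σ r` of the size table of every team; hence `I × I` must
    -- embed into the nodes.
    (fun G r v => #(P G (𝒯.move (𝒯.d v) (σ r).1) (σ r).2))
    (fun G u r => by
      rw [mem_coe, mem_range]
      exact Nat.lt_succ_of_le (hcardE _ _ _))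
    fun r G G' hκ => by
      funext v
      simpa [𝒯.d_e] using hκ.2 (𝒯.e (𝒯.move (𝒯.d v) (σ r).1))
  let C : SimpleGraph (Fin n) → Q → I → I → ℕ := fun G q x y => #(P G (𝒯.move q x) y)
  have hCmove : ∀ G q z, C G (𝒯.move q z) = C G q := fun G q z => by
    simp only [C, 𝒯.move_move]
  -- The colouring depends only on the size table, so all members of a team use the same one.
  let chi : (I → I → ℕ) → I → I → ℕ → ℕ := fun c =>
    if h : ∃ col, IsMessageColoring c (2 * N + 1) col then h.choose else fun _ _ _ => 0
  have hchi : ∀ G, Good G → ∀ q, IsMessageColoring (C G q) (2 * N + 1) (chi (C G q)) := by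
    intro G hG q
    have h : ∃ col, IsMessageColoring (C G q) (2 * N + 1) col := by
      apply exists_isMessageColoring
      · exact fun x => hrow G hG _
      · intro y
        have := hcol G hG (𝒯.move q y)
        simpa only [𝒯.move_move, 𝒯.idx_move] using this
    simp only [chi, dif_pos h]
    exact h.choose_spec
  -- A message of colour `r + n * j` travels through node `r` in round `j` of either phase. A colour
  -- occurs once per source and once per target, so each link carries at most one message per round.
  let m₁ : ℕ → SimpleGraph (Fin n) → Fin n → Fin n → Set (I × E) := fun j G u r =>
    {p | ∃ t, (P G (𝒯.d u) p.1).toList[t]? = some p.2 ∧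
      chi (C G (𝒯.d u)) (𝒯.idx (𝒯.d u)) p.1 t = r + n * j}
  -- Several nodes may act as the same member; only the messages of `e q` are passed on.
  let m₂ : ℕ → SimpleGraph (Fin n) → Fin n → Fin n → Set E := fun j G r v =>
    {a | ∃ q, 𝒯.move q (𝒯.idx (𝒯.d v)) = 𝒯.d v ∧
      (𝒯.idx (𝒯.d v), a) ∈ onlyElement (m₁ j G (𝒯.e q) r)}
  have hA' := (hA.exchangeSets (E := I × E) (by rw [Nat.card_prod]; exact hE) R m₁
    (fun u G G' hκ j _ => by
      have hC : C G (𝒯.d u) = C G' (𝒯.d u) := by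
        funext x y
        simpa [C, hρ] using hκ.2 (ρ (x, y))
      simp only [m₁, hC, hP u G G' hκ.1.1])).exchangeSets hE' R m₂
    (fun r G G' hκ j hj => by
      funext v
      simp only [m₂, hκ.2 j hj])
  have hT : T + 1 + 1 + R + R = T + 2 + 2 * R := by ring
  rw [hT] at hA'
  have hlt : ∀ G q x y t (a : E), (P G (𝒯.move q x) y).toList[t]? = some a → t < C G q x y := by
    intro G q x y t a hta
    simp only [C, ← length_toList]
    exact (List.getElem?_eq_some_iff.1 hta).1
  have hm₁ : ∀ G, Good G → ∀ j u r, (m₁ j G u r).Subsingleton := by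
    rintro G hG j u r ⟨y, a⟩ ⟨t, h1, h2⟩ ⟨y', a'⟩ ⟨t', h1', h2'⟩
    dsimp only at h1 h2 h1' h2'
    have hmi := 𝒯.move_idx (𝒯.d u)
    obtain ⟨rfl, rfl⟩ := (hchi G hG (𝒯.d u)).2.1 _ _ _ _ _ (hlt G _ _ _ t a (by rwa [hmi]))
      (hlt G _ _ _ t' a' (by rwa [hmi])) (h2.trans h2'.symm)
    rw [h1, Option.some_inj] at h1'
    rw [h1']
  have hteam : ∀ q q', 𝒯.move q (𝒯.idx q') = q' → q = 𝒯.move q' (𝒯.idx q) := by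
    intro q q' hq
    conv_rhs => rw [← hq, 𝒯.move_move, 𝒯.move_idx]
  have hm₂ : ∀ G, Good G → ∀ j r v a, a ∈ m₂ j G r v ↔ ∃ x t,
      (P G (𝒯.move (𝒯.d v) x) (𝒯.idx (𝒯.d v))).toList[t]? = some a ∧
      chi (C G (𝒯.d v)) x (𝒯.idx (𝒯.d v)) t = r + n * j := by
    intro G hG j r v a
    have hm : a ∈ m₂ j G r v ↔ ∃ q, 𝒯.move q (𝒯.idx (𝒯.d v)) = 𝒯.d v ∧
        (𝒯.idx (𝒯.d v), a) ∈ m₁ j G (𝒯.e q) r := by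
      refine exists_congr fun q => and_congr_right fun _ => ?_
      rw [onlyElement_of_subsingleton (hm₁ G hG j _ r)]
    rw [hm]
    simp only [m₁, 𝒯.d_e]
    constructor
    · rintro ⟨q, hq, t, h1, h2⟩
      have hq' := hteam _ _ hq
      refine ⟨𝒯.idx q, t, by rwa [← hq'], ?_⟩
      rwa [hq', hCmove, 𝒯.idx_move] at h2
    · rintro ⟨x, t, h1, h2⟩
      refine ⟨𝒯.move (𝒯.d v) x, ?_, t, h1, ?_⟩
      · rw [𝒯.move_move, 𝒯.move_idx]
      · rwa [hCmove, 𝒯.idx_move]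
  have hm₂s : ∀ G, Good G → ∀ j r v, (m₂ j G r v).Subsingleton := by
    intro G hG j r v a ha a' ha'
    obtain ⟨x, t, h1, h2⟩ := (hm₂ G hG j r v a).1 ha
    obtain ⟨x', t', h1', h2'⟩ := (hm₂ G hG j r v a').1 ha'
    obtain ⟨rfl, rfl⟩ := (hchi G hG (𝒯.d v)).2.2 _ _ _ _ _ (hlt _ _ _ _ _ _ h1)
      (hlt _ _ _ _ _ _ h1') (h2.trans h2'.symm)
    exact Option.some_inj.1 (h1.symm.trans h1')
  have hrecv : ∀ G, Good G → ∀ v a, (∃ j < R, ∃ r, a ∈ onlyElement (m₂ j G r v)) ↔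
      ∃ x, a ∈ P G (𝒯.move (𝒯.d v) x) (𝒯.idx (𝒯.d v)) := by
    intro G hG v a
    simp only [onlyElement_of_subsingleton (hm₂s G hG _ _ v), hm₂ G hG]
    constructor
    · rintro ⟨j, -, r, x, t, h1, -⟩
      exact ⟨x, by simpa using List.mem_of_getElem? h1⟩
    · rintro ⟨x, hx⟩
      obtain ⟨t, ht⟩ := List.mem_iff_getElem?.1 (mem_toList.2 hx)
      have hc := (hchi G hG (𝒯.d v)).1 _ _ _ (hlt _ _ _ _ _ _ ht)
      refine ⟨_, Nat.div_lt_of_lt_mul (hc.trans_le hR), ⟨_, Nat.mod_lt _ hn⟩, x, t, ht,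
        (Nat.mod_add_div _ n).symm⟩
  refine hA'.mono fun v G G' hκ => ⟨hκ.1.1.1.1, fun hG hG' a => ?_⟩
  rw [← hrecv G hG, ← hrecv G' hG']
  refine exists_congr fun j => and_congr_right fun hj => exists_congr fun r => ?_
  rw [hκ.2 j hj r]

end CongestedClique

/-! ### Cutting the nodes into balanced blocks -/

namespace CongestedClique

variable {n : ℕ}

open Classical in
/-- The number of neighbours of `v` in `X`. -/
noncomputable def degIn (G : SimpleGraph (Fin n)) (X : Finset (Fin n)) (v : Fin n) : ℕ :=
  #{w ∈ X | G.Adj v w}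

theorem degIn_le (G : SimpleGraph (Fin n)) (X : Finset (Fin n)) (v : Fin n) : degIn G X v ≤ n :=
  (card_le_univ _).trans (Fintype.card_fin n).le

@[simp] theorem degIn_empty (G : SimpleGraph (Fin n)) (v : Fin n) : degIn G ∅ v = 0 := by
  simp [degIn]

theorem sum_degIn_comm (G : SimpleGraph (Fin n)) (X Y : Finset (Fin n)) :
    ∑ v ∈ X, degIn G Y v = ∑ w ∈ Y, degIn G X w := by
  classical
  have := sum_card_bipartiteAbove_eq_sum_card_bipartiteBelow (s := X) (t := Y)
    (fun v w => G.Adj v w)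
  simp only [bipartiteAbove, bipartiteBelow] at this
  simp only [degIn]
  convert this using 4
  simp only [G.adj_comm]

/-- The `j`-th block when the nodes are cut, in their order, into `s` blocks of about equal weight,
where `W` is the maximal total weight. -/
def block (f : Fin n → ℕ) (s W j : ℕ) : Finset (Fin n) :=
  {v | s * (∑ u ∈ Iio v, f u) / (W + 1) = j}

theorem mem_block {f : Fin n → ℕ} {s W j : ℕ} {v : Fin n} :
    v ∈ block f s W j ↔ s * (∑ u ∈ Iio v, f u) / (W + 1) = j := by
  simp [block]

theorem exists_mem_block {f : Fin n → ℕ} {s W : ℕ} (hs : 0 < s) (hW : ∑ v, f v ≤ W) (v : Fin n) :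
    ∃ j < s, v ∈ block f s W j := by
  refine ⟨_, ?_, mem_block.2 rfl⟩
  rw [Nat.div_lt_iff_lt_mul (by omega)]
  have : ∑ u ∈ Iio v, f u ≤ W := (sum_le_univ_sum_of_nonneg (by simp)).trans hW
  nlinarith

/-- All nodes of a block but the last have total weight at most `W / s`. The last may have large
`f`, but is charged only its `c`, at most `b`. -/
theorem sum_block_le {f c : Fin n → ℕ} {s W j K b : ℕ} (hc : ∀ v, c v * K ≤ f v)
    (hb : ∀ v, c v ≤ b) : s * (∑ v ∈ block f s W j, c v) * K ≤ W + s * b * K := by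
  rcases (block f s W j).eq_empty_or_nonempty with he | hne
  · simp [he]
  set X := block f s W j with hX
  have ha := X.min'_mem hne
  have hz := X.max'_mem hne
  set a := X.min' hne with ha'
  set z := X.max' hne with hz'
  have h1 : ∑ u ∈ Iio a, f u + ∑ v ∈ X.erase z, f v ≤ ∑ u ∈ Iio z, f u := by
    rw [← sum_union]
    · refine sum_le_sum_of_subset fun u hu => ?_
      rw [mem_union, mem_Iio, mem_erase] at hu
      rw [mem_Iio]
      rcases hu with hu | hu
      · exact hu.trans_le (X.min'_le z hz)
      · exact lt_of_le_of_ne (X.le_max' u hu.2) hu.1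
    · rw [disjoint_left]
      intro u hu hu'
      rw [mem_Iio] at hu
      exact absurd (X.min'_le u (mem_of_mem_erase hu')) (not_le.2 hu)
  have h2 : (∑ v ∈ X, c v) * K ≤ ∑ v ∈ X.erase z, f v + b * K := by
    rw [← sum_erase_add _ _ hz, add_mul, sum_mul]
    exact Nat.add_le_add (sum_le_sum fun v _ => hc v) (Nat.mul_le_mul_right K (hb z))
  rw [hX, mem_block] at ha hz
  have h3 : j * (W + 1) ≤ s * ∑ u ∈ Iio a, f u := (Nat.le_div_iff_mul_le (by omega)).1 ha.ge
  have h4 : s * ∑ u ∈ Iio z, f u < (j + 1) * (W + 1) :=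
    (Nat.div_lt_iff_lt_mul (by omega)).1 (by omega)
  have h5 := Nat.mul_le_mul_left s h1
  have h6 := Nat.mul_le_mul_left s h2
  nlinarith

/-- The sets of consecutive nodes. -/
def intervals (n : ℕ) : Set (Finset (Fin n)) :=
  Set.range fun p : Fin (n + 1) × Fin (n + 1) =>
    ({v : Fin n | p.1 ≤ v.castSucc ∧ v.castSucc < p.2} : Finset (Fin n))

theorem finite_intervals (n : ℕ) : (intervals n).Finite := Set.finite_range _

theorem ncard_intervals_le (n : ℕ) : (intervals n).ncard ≤ (n + 1) * (n + 1) := by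
  rw [intervals, ← Set.image_univ]
  refine (Set.ncard_image_le).trans ?_
  simp [Set.ncard_univ]

/-- An interval is encoded by its two ends, so a block fits into one message. -/
theorem block_mem_intervals (f : Fin n → ℕ) (s W j : ℕ) : block f s W j ∈ intervals n := by
  rcases (block f s W j).eq_empty_or_nonempty with he | hne
  · exact ⟨(0, 0), by simp [he]⟩
  refine ⟨(((block f s W j).min' hne).castSucc, ((block f s W j).max' hne).succ), ?_⟩
  ext v
  simp only [mem_filter, mem_univ, true_and, Fin.castSucc_le_castSucc_iff, Fin.castSucc_lt_succ_iff]
  constructor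
  · rintro ⟨h1, h2⟩
    have ha := mem_block.1 ((block f s W j).min'_mem hne)
    have hz := mem_block.1 ((block f s W j).max'_mem hne)
    rw [mem_block]
    have mono : ∀ u v : Fin n, u ≤ v → s * (∑ w ∈ Iio u, f w) / (W + 1) ≤
        s * (∑ w ∈ Iio v, f w) / (W + 1) := fun u v huv =>
      Nat.div_le_div_right (Nat.mul_le_mul_left _ (sum_le_sum_of_subset (Iio_subset_Iio huv)))
    exact le_antisymm ((mono _ _ h2).trans hz.le) (ha.ge.trans (mono _ _ h1))
  · exact fun hv => ⟨min'_le _ _ hv, le_max' _ _ hv⟩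

/-- A weight by which both the degrees, of sum at most `M`, and the degrees into two sets, of sum at
most `D`, are balanced. -/
noncomputable def weight (M D : ℕ) (G : SimpleGraph (Fin n)) (X Y : Finset (Fin n)) (v : Fin n) :
    ℕ :=
  degIn G univ v * D + (degIn G X v + degIn G Y v) * M

/-- The sets of nodes between which the node with the sequence `σ` looks for edges. -/
noncomputable def part (s M D : ℕ) (G : SimpleGraph (Fin n)) (σ : ℕ → ℕ) : ℕ → Finset (Fin n)
  | 0 => block (weight M D G ∅ ∅) s (3 * M * D) (σ 0)
  -- Degrees into the first set are balanced at every place, because the last set must also pair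
  -- with it. On sparse graphs the total weight is at most `M * D + (D + D) * M`.
  | i + 1 => block (weight M D G (part s M D G σ i) (part s M D G σ 0)) s (3 * M * D) (σ (i + 1))

section part

variable {s M D : ℕ} {G G' : SimpleGraph (Fin n)} {σ σ' : ℕ → ℕ}

theorem part_zero : part s M D G σ 0 = block (weight M D G ∅ ∅) s (3 * M * D) (σ 0) := by
  rw [part]

theorem part_succ (i : ℕ) : part s M D G σ (i + 1) =
    block (weight M D G (part s M D G σ i) (part s M D G σ 0)) s (3 * M * D) (σ (i + 1)) := by
  conv_lhs => rw [part]

theorem exists_part_eq_block (s M D : ℕ) (G : SimpleGraph (Fin n)) (σ : ℕ → ℕ) (i : ℕ) :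
    ∃ X Y, part s M D G σ i = block (weight M D G X Y) s (3 * M * D) (σ i) := by
  cases i with
  | zero => exact ⟨_, _, part_zero⟩
  | succ i => exact ⟨_, _, part_succ i⟩

theorem part_mem_intervals (i : ℕ) : part s M D G σ i ∈ intervals n := by
  obtain ⟨X, Y, h⟩ := exists_part_eq_block s M D G σ i
  exact h ▸ block_mem_intervals _ _ _ _

theorem part_congr {i : ℕ} (h : ∀ j ≤ i, σ j = σ' j) : part s M D G σ i = part s M D G σ' i := by
  induction i with
  | zero => simp [part_zero, h 0 le_rfl]
  | succ i ih =>
    have h0 : part s M D G σ 0 = part s M D G σ' 0 := by simp [part_zero, h 0 (by omega)]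
    rw [part_succ, part_succ, ih fun j hj => h j (by omega), h0, h _ le_rfl]

/-- The cut depends only on the earlier numbers, and blocks of one cut are disjoint; so an edge is
forwarded to a single team member. -/
theorem index_eq_of_mem_part {i : ℕ} (h : ∀ j < i, σ j = σ' j) {v : Fin n}
    (hv : v ∈ part s M D G σ i) (hv' : v ∈ part s M D G σ' i) : σ i = σ' i := by
  cases i with
  | zero =>
    rw [part_zero, mem_block] at hv hv'
    exact hv.symm.trans hv'
  | succ i =>
    rw [part_succ, mem_block] at hv hv'
    rw [part_congr (i := i) fun j hj => h j (by omega),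
      part_congr (i := 0) fun j hj => h j (by omega)] at hv
    exact hv.symm.trans hv'

theorem part_zero_eq (h : ∀ v, degIn G univ v = degIn G' univ v) :
    part s M D G σ 0 = part s M D G' σ 0 := by
  have : weight M D G ∅ ∅ = weight M D G' ∅ ∅ := by
    funext v
    simp [weight, h v]
  rw [part_zero, part_zero, this]

theorem part_succ_eq {i : ℕ} (h : ∀ v, degIn G univ v = degIn G' univ v)
    (hi : ∀ v, degIn G (part s M D G σ i) v = degIn G' (part s M D G' σ i) v)
    (h0 : ∀ v, degIn G (part s M D G σ 0) v = degIn G' (part s M D G' σ 0) v) :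
    part s M D G σ (i + 1) = part s M D G' σ (i + 1) := by
  have : weight M D G (part s M D G σ i) (part s M D G σ 0) =
      weight M D G' (part s M D G' σ i) (part s M D G' σ 0) := by
    funext v
    simp [weight, h v, hi v, h0 v]
  rw [part_succ, part_succ, this]

theorem sum_degIn_part_le (hs : 0 < s) (hM : 0 < M) (hsD : 3 * M + s * n ≤ s * D) (i : ℕ) :
    ∑ v ∈ part s M D G σ i, degIn G univ v ≤ D := by
  have hD : 0 < D := Nat.pos_of_ne_zero fun h => by subst h; omega
  have key : ∀ X Y j, ∑ v ∈ block (weight M D G X Y) s (3 * M * D) j, degIn G univ v ≤ D := by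
    intro X Y j
    have := sum_block_le (f := weight M D G X Y) (c := degIn G univ) (s := s) (W := 3 * M * D)
      (j := j) (K := D) (b := n) (fun v => Nat.le_add_right _ _) (degIn_le G univ)
    refine Nat.le_of_mul_le_mul_left (Nat.le_of_mul_le_mul_right (this.trans ?_) hD) hs
    rw [← add_mul]
    exact Nat.mul_le_mul_right D hsD
  obtain ⟨X, Y, h⟩ := exists_part_eq_block s M D G σ i
  exact h ▸ key X Y _

/-- The factor `M` of this term of `weight` cancels against the total `3 * M * D`, which leaves a
share `3 * D / s` plus the degree of one node. -/
theorem sum_degIn_part_succ_le (hM : 0 < M) (i : ℕ) :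
    s * ∑ v ∈ part s M D G σ (i + 1), degIn G (part s M D G σ i) v ≤ 3 * D + s * n ∧
    s * ∑ v ∈ part s M D G σ (i + 1), degIn G (part s M D G σ 0) v ≤ 3 * D + s * n := by
  have key : ∀ X Y j (c : Fin n → ℕ), (∀ v, c v * M ≤ weight M D G X Y v) → (∀ v, c v ≤ n) →
      s * ∑ v ∈ block (weight M D G X Y) s (3 * M * D) j, c v ≤ 3 * D + s * n := by
    intro X Y j c hc hcn
    refine Nat.le_of_mul_le_mul_right ((sum_block_le hc hcn).trans (le_of_eq ?_)) hM
    ring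
  constructor <;> rw [part_succ]
  · refine key _ _ _ _ (fun v => ?_) (degIn_le G _)
    rw [weight]
    nlinarith
  · refine key _ _ _ _ (fun v => ?_) (degIn_le G _)
    rw [weight]
    nlinarith

/-- Block numbers are chosen in order: the cut at place `m` is fixed by the earlier ones, and
sparsity keeps its total weight within bounds, so its `s` blocks cover `x m`. -/
theorem exists_mem_part (hs : 0 < s) (hM : 0 < M) (hsD : 3 * M + s * n ≤ s * D)
    (hG : ∑ v, degIn G univ v ≤ M) (x : ℕ → Fin n) (m : ℕ) :
    ∃ σ : ℕ → ℕ, ∀ i < m, σ i < s ∧ x i ∈ part s M D G σ i := by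
  induction m with
  | zero => exact ⟨fun _ => 0, by simp⟩
  | succ m ih =>
    obtain ⟨σ, hσ⟩ := ih
    have hpart : ∀ i, ∑ v, degIn G (part s M D G σ i) v ≤ D := fun i => by
      rw [sum_degIn_comm]
      exact sum_degIn_part_le hs hM hsD i
    obtain ⟨j, hj, hx⟩ : ∃ j < s, x m ∈ part s M D G (Function.update σ m j) m := by
      cases m with
      | zero =>
        simp only [part_zero, Function.update_self]
        refine exists_mem_block hs ?_ _
        simp only [weight, degIn_empty, add_zero, zero_mul, ← sum_mul]
        nlinarith
      | succ m =>
        have : ∀ j, part s M D G (Function.update σ (m + 1) j) (m + 1) =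
            block (weight M D G (part s M D G σ m) (part s M D G σ 0)) s (3 * M * D) j := by
          intro j
          rw [part_succ, Function.update_self]
          congr 2
          · exact part_congr fun i hi => Function.update_of_ne (by omega) _ _
          · exact part_congr fun i hi => Function.update_of_ne (by omega) _ _
        simp only [this]
        refine exists_mem_block hs ?_ _
        simp only [weight, sum_add_distrib, ← sum_mul]
        have := hpart m
        have := hpart 0
        nlinarith
    refine ⟨Function.update σ m j, fun i hi => ?_⟩
    rcases Nat.lt_succ_iff_lt_or_eq.mp hi with hi | rfl
    · rw [Function.update_of_ne hi.ne,
        part_congr (σ' := σ) fun l hl => Function.update_of_ne (by omega) _ _]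
      exact hσ i hi
    · rw [Function.update_self]
      exact ⟨hj, hx⟩

end part

/-! ### Numbering the directed edges -/

/-- The position of the directed edge `(v, w)` in the lexicographic order of the directed edges. -/
noncomputable def edgePos (G : SimpleGraph (Fin n)) (v w : Fin n) : ℕ :=
  ∑ u ∈ Iio v, degIn G univ u + degIn G (Iio w) v

theorem degIn_Iio_lt {G : SimpleGraph (Fin n)} {v w : Fin n} (h : G.Adj v w) {X : Finset (Fin n)}
    (hX : Iio w ⊆ X) (hw : w ∈ X) : degIn G (Iio w) v < degIn G X v := by
  classical
  refine card_lt_card ⟨filter_subset_filter _ hX, fun hsub => ?_⟩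
  have := hsub (mem_filter.2 ⟨hw, h⟩)
  simp at this

theorem edgePos_lt {G : SimpleGraph (Fin n)} {v w : Fin n} (h : G.Adj v w) :
    edgePos G v w < ∑ u ∈ Iio v, degIn G univ u + degIn G univ v :=
  Nat.add_lt_add_left (degIn_Iio_lt h (subset_univ _) (mem_univ _)) _

theorem edgePos_lt_sum {G : SimpleGraph (Fin n)} {v w : Fin n} (h : G.Adj v w) :
    edgePos G v w < ∑ u, degIn G univ u := by
  refine (edgePos_lt h).trans_le ?_
  rw [add_comm, ← sum_insert (by simp)]
  exact sum_le_sum_of_subset (subset_univ _)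

theorem edgePos_lt_of_lt {G : SimpleGraph (Fin n)} {v w v' w' : Fin n} (h : G.Adj v w)
    (hv : v < v') : edgePos G v w < edgePos G v' w' := by
  refine (edgePos_lt h).trans_le (le_trans ?_ (Nat.le_add_right _ _))
  rw [add_comm, ← sum_insert (by simp)]
  refine sum_le_sum_of_subset fun u hu => ?_
  rw [mem_insert, mem_Iio] at hu
  rw [mem_Iio]
  rcases hu with rfl | hu
  · exact hv
  · exact hu.trans hv

theorem edgePos_injective {G : SimpleGraph (Fin n)} {v w v' w' : Fin n} (h : G.Adj v w)
    (h' : G.Adj v' w') (e : edgePos G v w = edgePos G v' w') : v = v' ∧ w = w' := by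
  have hmono : ∀ {w w'}, G.Adj v w → w < w' → edgePos G v w < edgePos G v w' := fun h hw =>
    Nat.add_lt_add_left (degIn_Iio_lt h (Iio_subset_Iio hw.le) (mem_Iio.2 hw)) _
  rcases lt_trichotomy v v' with hv | rfl | hv
  · exact absurd e (edgePos_lt_of_lt h hv).ne
  · rcases lt_trichotomy w w' with hw | rfl | hw
    · exact absurd e (hmono h hw).ne
    · exact ⟨rfl, rfl⟩
    · exact absurd e (hmono h' hw).ne'
  · exact absurd e (edgePos_lt_of_lt h' hv).ne'

/-- The edges out of `v` fill at most `n` consecutive positions; so dealing edges by position modulo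
`n` takes one round. -/
theorem edgePos_mod_injective {G : SimpleGraph (Fin n)} {v w w' : Fin n} (h : G.Adj v w)
    (h' : G.Adj v w') (e : edgePos G v w % n = edgePos G v w' % n) : w = w' := by
  have hlt : ∀ {w}, G.Adj v w → degIn G (Iio w) v < n := fun h =>
    (degIn_Iio_lt h (subset_univ _) (mem_univ _)).trans_le (degIn_le G _ v)
  have : degIn G (Iio w) v = degIn G (Iio w') v :=
    Nat.ModEq.eq_of_lt_of_lt (Nat.ModEq.add_left_cancel' _ e) (hlt h) (hlt h')
  exact (edgePos_injective h h' (by rw [edgePos, edgePos, this])).2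

end CongestedClique

/-! ### Collecting the edges between consecutive sets -/

namespace CongestedClique

/-- The parameters of the algorithm that looks for closed walks of length `ℓ` in graphs with at most
`M` directed edges, on `n` nodes of which `e q` looks at the sequence `q` of blocks. -/
structure Params (n : ℕ) where
  s : ℕ
  ℓ : ℕ
  M : ℕ
  D : ℕ
  R : ℕ
  N : ℕ
  R' : ℕ
  s_pos : 0 < s
  M_pos : 0 < M
  M_eq : M = n * (s * s * R)
  le_D : 3 * M + s * n ≤ s * D
  D_le : 3 * D + s * n ≤ s * N
  R_le : n * R ≤ N
  N_lt : 2 * N + 1 ≤ n * R'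
  e : (Fin ℓ → Fin s) → Fin n
  d : Fin n → Fin ℓ → Fin s
  d_e : ∀ q, d (e q) = q
  ρ : (Fin s × Fin s) × (Fin s × Fin s) → Fin n
  σ : Fin n → (Fin s × Fin s) × (Fin s × Fin s)
  σ_ρ : ∀ x, σ (ρ x) = x

namespace Params

variable {n B T : ℕ} (p : Params n)

/-- The sequence of blocks `q`, continued by zeros. -/
def seq (q : Fin p.ℓ → Fin p.s) (i : ℕ) : ℕ := if h : i < p.ℓ then q ⟨i, h⟩ else 0

/-- The `i`-th set of nodes that belongs to the sequence `q`. -/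
noncomputable def X (G : SimpleGraph (Fin n)) (q : Fin p.ℓ → Fin p.s) (i : ℕ) : Finset (Fin n) :=
  part p.s p.M p.D G (p.seq q) i

/-- The graphs with at most `M` directed edges. -/
def Sparse (G : SimpleGraph (Fin n)) : Prop := ∑ v, degIn G univ v ≤ p.M

end Params

theorem degIn_congr {n : ℕ} {G G' : SimpleGraph (Fin n)} {v : Fin n}
    (h : G.neighborSet v = G'.neighborSet v) (X : Finset (Fin n)) :
    degIn G X v = degIn G' X v := by
  have : ∀ w, G.Adj v w ↔ G'.Adj v w := fun w => Set.ext_iff.1 h w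
  unfold degIn
  congr 1
  ext w
  simp [this]

theorem Attains.degrees {n B : ℕ} (hB : (n + 1) ^ 4 ≤ 2 ^ B) :
    Attains n B 1 fun v G G' => G.neighborSet v = G'.neighborSet v ∧
      ∀ u, degIn G univ u = degIn G' univ u := by
  refine (Attains.start n B).exchange (range (n + 1) : Finset ℕ) (finite_toSet _) ?_
    (fun G u _ => degIn G univ u) (fun G u v => ?_) (fun u G G' h => ?_)
  · rw [Set.ncard_coe_finset, card_range]
    exact (Nat.le_self_pow (by norm_num) _).trans hB
  · rw [mem_coe, mem_range]
    exact Nat.lt_succ_of_le (degIn_le _ _ _)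
  · funext v
    exact degIn_congr h _

namespace Params

variable {n B T : ℕ} (p : Params n)

/-- What a node knows after `m` sets of nodes have been computed for each sequence of blocks. -/
def KnowsParts (m : ℕ) (v : Fin n) (G G' : SimpleGraph (Fin n)) : Prop :=
  (G.neighborSet v = G'.neighborSet v ∧ ∀ u, degIn G univ u = degIn G' univ u) ∧
  (∀ i < m, ∀ q, p.X G q i = p.X G' q i) ∧
  ∀ i < m, ∀ u, degIn G (p.X G (p.d v) i) u = degIn G' (p.X G' (p.d v) i) u

/-- Per place, nodes announce the set of their own sequence, then each node reports to `v` its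
degree into the set of `v`. These degrees determine the next cut. -/
theorem attains_knowsParts (hB : (n + 1) ^ 4 ≤ 2 ^ B) (m : ℕ) :
    Attains n B (1 + 2 * m) (p.KnowsParts m) := by
  induction m with
  | zero => exact (Attains.degrees hB).mono fun v G G' h => ⟨h, by simp, by simp⟩
  | succ m ih =>
    have h1 := (ih.exchange _ (finite_intervals n) ((ncard_intervals_le n).trans (le_trans
      (by rw [← sq]; exact Nat.pow_le_pow_right (by omega) (by norm_num)) hB))
      (fun G u _ => p.X G (p.d u) m) (fun G u v => part_mem_intervals m) (fun u G G' h => by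
        funext _
        cases m with
        | zero => exact part_zero_eq h.1.2
        | succ m => exact part_succ_eq h.1.2 (h.2.2 m (by omega)) (h.2.2 0 (by omega)))).exchange
      (range (n + 1) : Finset ℕ) (finite_toSet _) (by
        rw [Set.ncard_coe_finset, card_range]
        exact (Nat.le_self_pow (by norm_num) _).trans hB)
      (fun G u v => degIn G (p.X G (p.d v) m) u) (fun G u v => by
        rw [mem_coe, mem_range]
        exact Nat.lt_succ_of_le (degIn_le _ _ _)) (fun u G G' h => by
        funext v
        have := h.2 (p.e (p.d v))
        rw [p.d_e] at this
        simp only [this]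
        exact degIn_congr h.1.1.1 _)
    refine h1.mono fun v G G' h => ⟨h.1.1.1, fun i hi q => ?_, fun i hi u => ?_⟩
    · rcases Nat.lt_succ_iff_lt_or_eq.mp hi with hi | rfl
      · exact h.1.1.2.1 i hi q
      · simpa [p.d_e] using h.1.2 (p.e q)
    · rcases Nat.lt_succ_iff_lt_or_eq.mp hi with hi | rfl
      · exact h.1.1.2.2 i hi u
      · exact h.2 u

/-- Node `v` knows the edges whose position is `v` modulo `n`. -/
def KnowsShare (v : Fin n) (G G' : SimpleGraph (Fin n)) : Prop :=
  ∀ a b i, i % n = v →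
    (G.Adj a b ∧ edgePos G a b = i ↔ G'.Adj a b ∧ edgePos G' a b = i)

theorem attains_knowsShare (hB : (n + 1) ^ 4 ≤ 2 ^ B) {m : ℕ}
    (h : Attains n B T (p.KnowsParts m)) :
    Attains n B (T + 1) fun v G G' => p.KnowsParts m v G G' ∧ KnowsShare v G G' := by
  let msg : ℕ → SimpleGraph (Fin n) → Fin n → Fin n → Set (Fin n × Fin (n * n)) :=
    fun _ G v r => {x | G.Adj v x.1 ∧ edgePos G v x.1 = x.2 ∧ (x.2 : ℕ) % n = r}
  have hmsg : ∀ j G v r, (msg j G v r).Subsingleton := by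
    rintro j G v r ⟨w, i⟩ ⟨h1, h2, h3⟩ ⟨w', i'⟩ ⟨h1', h2', h3'⟩
    dsimp only at h1 h2 h3 h1' h2' h3'
    obtain rfl := edgePos_mod_injective h1 h1' (by rw [h2, h3, h2', h3'])
    rw [Prod.mk.injEq]
    exact ⟨rfl, Fin.ext (h2.symm.trans h2')⟩
  refine (h.exchangeSets ?_ 1 msg fun v G G' h j _ => ?_).mono fun v G G' h => ⟨h.1, ?_⟩
  · rw [Nat.card_prod, Nat.card_fin, Nat.card_fin]
    refine le_trans ?_ hB
    nlinarith [Nat.zero_le n, Nat.zero_le (n * n), Nat.zero_le (n * n * n),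
      Nat.zero_le (n * n * n * n)]
  · have hadj : ∀ w, G.Adj v w ↔ G'.Adj v w := fun w => Set.ext_iff.1 h.1.1 w
    have hpos : ∀ w, edgePos G v w = edgePos G' v w := fun w => by
      simp only [edgePos, h.1.2, degIn_congr h.1.1]
    simp only [msg, hadj, hpos]
  · have key : ∀ G a b i, i % n = v → (G.Adj a b ∧ edgePos G a b = i ↔
        ∃ hi : i < n * n, (b, (⟨i, hi⟩ : Fin (n * n))) ∈ msg 0 G a v) := by
      intro G a b i hi
      constructor
      · rintro ⟨h1, h2⟩
        refine ⟨?_, h1, h2, hi⟩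
        rw [← h2]
        refine (edgePos_lt_sum h1).trans_le ((sum_le_card_nsmul _ _ n fun u _ =>
          degIn_le _ _ _).trans ?_)
        simp
      · rintro ⟨_, h1, h2, -⟩
        exact ⟨h1, h2⟩
    intro a b i hi
    have := h.2 0 one_pos a
    rw [onlyElement_of_subsingleton (hmsg 0 _ _ _), onlyElement_of_subsingleton (hmsg 0 _ _ _)]
      at this
    rw [key G a b i hi, key G' a b i hi, this]

/-- Sequences that differ at most at the places `a` and `b` form a team. -/
def teams {a b : ℕ} (hab : a < b) (hb : b < p.ℓ) :
    Teams n (Fin p.ℓ → Fin p.s) (Fin p.s × Fin p.s) where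
  e := p.e
  d := p.d
  d_e := p.d_e
  idx q := (q ⟨a, hab.trans hb⟩, q ⟨b, hb⟩)
  move q x := Function.update (Function.update q ⟨a, hab.trans hb⟩ x.1) ⟨b, hb⟩ x.2
  idx_move q x := by
    have : (⟨a, hab.trans hb⟩ : Fin p.ℓ) ≠ ⟨b, hb⟩ := by simp [hab.ne]
    simp [this]
  move_idx q := by simp
  move_move q x y := by
    have : (⟨a, hab.trans hb⟩ : Fin p.ℓ) ≠ ⟨b, hb⟩ := by simp [hab.ne]
    rw [Function.update_comm this, Function.update_idem, Function.update_comm this.symm,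
      Function.update_idem]

/-- The team member to which an edge at position `i` is dealt. -/
noncomputable def classOf (i : ℕ) : Fin p.s × Fin p.s :=
  finProdFinEquiv.symm ⟨i / n % (p.s * p.s), Nat.mod_lt _ (Nat.mul_pos p.s_pos p.s_pos)⟩

open Classical in
/-- The edges that `q` forwards to the member `y` of its team. -/
noncomputable def forward {a b : ℕ} (hab : a < b) (hb : b < p.ℓ) (G : SimpleGraph (Fin n))
    (q : Fin p.ℓ → Fin p.s) (y : Fin p.s × Fin p.s) : Finset (Fin n × Fin n) :=
  -- The cap at `M` bounds the load on every graph; sparse graphs lose no edge by it.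
  {x | (G.Adj x.1 x.2 ∧ p.classOf (edgePos G x.1 x.2) = (p.teams hab hb).idx q ∧
      edgePos G x.1 x.2 < p.M) ∧
    x.1 ∈ p.X G ((p.teams hab hb).move q y) a ∧ x.2 ∈ p.X G ((p.teams hab hb).move q y) b}

section

variable {a b : ℕ} (hab : a < b) (hb : b < p.ℓ) {G G' : SimpleGraph (Fin n)}

theorem mem_forward {q : Fin p.ℓ → Fin p.s} {y : Fin p.s × Fin p.s} {x : Fin n × Fin n} :
    x ∈ p.forward hab hb G q y ↔ (G.Adj x.1 x.2 ∧
      p.classOf (edgePos G x.1 x.2) = (p.teams hab hb).idx q ∧ edgePos G x.1 x.2 < p.M) ∧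
      x.1 ∈ p.X G ((p.teams hab hb).move q y) a ∧ x.2 ∈ p.X G ((p.teams hab hb).move q y) b := by
  simp [forward]

/-- A position is determined by its residue modulo `n`, its class, and a quotient below `R`. -/
theorem card_classOf_le (c : Fin p.s × Fin p.s) :
    #{i ∈ range p.M | p.classOf i = c} ≤ n * p.R := by
  have hS : 0 < p.s * p.s := Nat.mul_pos p.s_pos p.s_pos
  have hn : 0 < n := Nat.pos_of_ne_zero (left_ne_zero_of_mul (p.M_eq ▸ p.M_pos).ne')
  have hcard : #(range n ×ˢ range p.R) = n * p.R := by simp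
  rw [← hcard]
  refine card_le_card_of_injOn (fun i => (i % n, i / n / (p.s * p.s))) (fun i hi => ?_)
    fun i hi i' hi' h => ?_
  · rw [mem_coe, mem_filter, mem_range, p.M_eq] at hi
    rw [mem_coe, mem_product, mem_range, mem_range]
    exact ⟨Nat.mod_lt _ hn, Nat.div_lt_of_lt_mul (Nat.div_lt_of_lt_mul hi.1)⟩
  · rw [mem_coe, mem_filter] at hi hi'
    have hc := hi.2.trans hi'.2.symm
    rw [classOf, classOf, EmbeddingLike.apply_eq_iff_eq, Fin.mk.injEq] at hc
    rw [Prod.mk.injEq] at h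
    rw [← Nat.mod_add_div i n, ← Nat.mod_add_div i' n, h.1, ← Nat.mod_add_div (i / n) (p.s * p.s),
      ← Nat.mod_add_div (i' / n) (p.s * p.s), hc, h.2]

theorem seq_update_of_ne {q : Fin p.ℓ → Fin p.s} {c : ℕ} (hc : c < p.ℓ) {i : ℕ} (hi : i ≠ c)
    (x : Fin p.s) : p.seq (Function.update q ⟨c, hc⟩ x) i = p.seq q i := by
  unfold seq
  split_ifs with h
  · rw [Function.update_of_ne (by simpa using hi)]
  · rfl

theorem seq_update_self {q : Fin p.ℓ → Fin p.s} {c : ℕ} (hc : c < p.ℓ) (x : Fin p.s) :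
    p.seq (Function.update q ⟨c, hc⟩ x) c = x := by
  simp [seq, hc]

theorem sum_card_forward_le (q : Fin p.ℓ → Fin p.s) :
    ∑ y, #(p.forward hab hb G q y) ≤ n * p.R := by
  classical
  rw [← card_biUnion]
  · refine le_trans ?_ (p.card_classOf_le ((p.teams hab hb).idx q))
    refine card_le_card_of_injOn (fun x => edgePos G x.1 x.2) (fun x hx => ?_)
      fun x hx x' hx' h => ?_
    · rw [mem_coe, mem_biUnion] at hx
      obtain ⟨y, -, hx⟩ := hx
      rw [mem_forward] at hx
      rw [mem_coe, mem_filter, mem_range]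
      exact ⟨hx.1.2.2, hx.1.2.1⟩
    · rw [mem_coe, mem_biUnion] at hx hx'
      obtain ⟨y, -, hx⟩ := hx
      obtain ⟨y', -, hx'⟩ := hx'
      rw [mem_forward] at hx hx'
      have := edgePos_injective hx.1.1 hx'.1.1 h
      exact Prod.ext this.1 this.2
  · intro y _ y' _ hyy
    refine disjoint_left.2 fun x hx hx' => ?_
    rw [mem_forward] at hx hx'
    apply hyy
    have e1 : y.1 = y'.1 := by
      have := index_eq_of_mem_part (fun j hj => ?_) hx.2.1 hx'.2.1
      · simp only [teams] at this
        rwa [seq_update_of_ne _ _ hab.ne, seq_update_of_ne _ _ hab.ne, seq_update_self,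
          seq_update_self, ← Fin.ext_iff] at this
      · simp only [teams]
        rw [seq_update_of_ne _ _ (by omega), seq_update_of_ne _ _ (by omega),
          seq_update_of_ne _ _ (by omega), seq_update_of_ne _ _ (by omega)]
    -- The cut at place `b` may depend on the number at place `a`, so `e1` is needed here.
    have e2 : y.2 = y'.2 := by
      have := index_eq_of_mem_part (fun j hj => ?_) hx.2.2 hx'.2.2
      · simp only [teams] at this
        rwa [seq_update_self, seq_update_self, ← Fin.ext_iff] at this
      · simp only [teams]
        rw [p.seq_update_of_ne hb (by omega), p.seq_update_of_ne hb (by omega), e1]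
    exact Prod.ext e1 e2

/-- An edge has one class, so it reaches `q` from one member only; and the `b`-th set was cut to
balance degrees into the `a`-th, which needs `hpair`. -/
theorem sum_card_forward_move_le (hpair : b = a + 1 ∨ a = 0) (q : Fin p.ℓ → Fin p.s) :
    ∑ x, #(p.forward hab hb G ((p.teams hab hb).move q x) ((p.teams hab hb).idx q)) ≤ p.N := by
  classical
  rw [← card_biUnion]
  · have h1 : ∑ v ∈ p.X G q b, degIn G (p.X G q a) v ≤ p.N := by
      refine Nat.le_of_mul_le_mul_left (le_trans ?_ p.D_le) p.s_pos
      obtain ⟨b, rfl⟩ : ∃ b', b = b' + 1 := ⟨b - 1, by omega⟩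
      rcases hpair with h | rfl
      · obtain rfl : b = a := by omega
        exact (sum_degIn_part_succ_le p.M_pos b).1
      · exact (sum_degIn_part_succ_le p.M_pos b).2
    refine le_trans ?_ h1
    rw [sum_degIn_comm]
    simp only [degIn]
    rw [← card_sigma]
    refine card_le_card_of_injOn (fun x => ⟨x.1, x.2⟩) (fun x hx => ?_) fun x _ x' _ h => ?_
    · rw [mem_coe, mem_biUnion] at hx
      obtain ⟨y, -, hx⟩ := hx
      rw [mem_forward, Teams.move_move, Teams.move_idx] at hx
      simp only [coe_sigma, Set.mem_sigma_iff, mem_coe, mem_filter]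
      exact ⟨hx.2.1, hx.2.2, hx.1.1⟩
    · simp only [Sigma.mk.injEq, heq_eq_eq] at h
      exact Prod.ext h.1 h.2
  · intro y _ y' _ hyy
    refine disjoint_left.2 fun x hx hx' => ?_
    rw [mem_forward, Teams.idx_move] at hx hx'
    exact hyy (hx.1.2.1.symm.trans hx'.1.2.1)

/-- Node `v` knows the edges between the `a`-th and the `b`-th set of its sequence. -/
def KnowsPair (a b : ℕ) (v : Fin n) (G G' : SimpleGraph (Fin n)) : Prop :=
  p.Sparse G → p.Sparse G' → ∀ x y,
    (G.Adj x y ∧ x ∈ p.X G (p.d v) a ∧ y ∈ p.X G (p.d v) b ↔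
      G'.Adj x y ∧ x ∈ p.X G' (p.d v) a ∧ y ∈ p.X G' (p.d v) b)

theorem attains_knowsPair (hab : a < b) (hb : b < p.ℓ) (hB : (n + 1) ^ 4 ≤ 2 ^ B) (hs : p.s * p.s ≤ n)
    (hpair : b = a + 1 ∨ a = 0)
    {κ : Fin n → SimpleGraph (Fin n) → SimpleGraph (Fin n) → Prop} (h : Attains n B T κ)
    (hκ : ∀ v G G', κ v G G' → p.KnowsParts p.ℓ v G G' ∧ KnowsShare v G G') :
    Attains n B (T + (p.R + 2 + 2 * p.R')) fun v G G' => κ v G G' ∧ p.KnowsPair a b v G G' := by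
  have hn : 0 < n := (Nat.mul_pos p.s_pos p.s_pos).trans_le hs
  have hS : 0 < p.s * p.s := Nat.mul_pos p.s_pos p.s_pos
  set 𝒯 := p.teams hab hb with h𝒯
  -- These are the positions in the share of node `r` whose class is the index of `v` in its team;
  -- those below `M` have `j < R`.
  let slot : Fin n → ℕ → Fin n → ℕ := fun v j r =>
    r + n * (finProdFinEquiv (𝒯.idx (p.d v)) + p.s * p.s * j)
  let msg : ℕ → SimpleGraph (Fin n) → Fin n → Fin n → Set (Fin n × Fin n) := fun j G r v =>
    {x | G.Adj x.1 x.2 ∧ edgePos G x.1 x.2 = slot v j r}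
  have hmsg : ∀ j G r v, (msg j G r v).Subsingleton := by
    rintro j G r v x ⟨h1, h2⟩ x' ⟨h1', h2'⟩
    have := edgePos_injective h1 h1' (h2.trans h2'.symm)
    exact Prod.ext this.1 this.2
  have hdeal := h.exchangeSets (by
    rw [Nat.card_prod, Nat.card_fin]
    refine le_trans ?_ hB
    nlinarith [Nat.zero_le n, Nat.zero_le (n * n), Nat.zero_le (n * n * n),
      Nat.zero_le (n * n * n * n)]) p.R msg (fun r G G' hh j _ => by
    funext v
    ext x
    exact (hκ r G G' hh).2 x.1 x.2 (slot v j r) (by simp [slot, Nat.mod_eq_of_lt]))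
  have hclass : ∀ v G G', (∀ j < p.R, ∀ u, onlyElement (msg j G u v) = onlyElement (msg j G' u v)) →
      ∀ i < p.M, p.classOf i = 𝒯.idx (p.d v) → ∀ x y,
      (G.Adj x y ∧ edgePos G x y = i ↔ G'.Adj x y ∧ edgePos G' x y = i) := by
    intro v G G' hh i hi hc x y
    rw [p.M_eq] at hi
    have hslot : slot v (i / n / (p.s * p.s)) ⟨i % n, Nat.mod_lt _ hn⟩ = i := by
      simp only [slot, ← hc, classOf, Equiv.apply_symm_apply, Nat.mod_add_div]
    have := hh (i / n / (p.s * p.s)) (Nat.div_lt_of_lt_mul (Nat.div_lt_of_lt_mul hi))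
      ⟨i % n, Nat.mod_lt _ hn⟩
    rw [onlyElement_of_subsingleton (hmsg _ _ _ _), onlyElement_of_subsingleton (hmsg _ _ _ _)]
      at this
    have := Set.ext_iff.1 this (x, y)
    rw [← hslot]
    exact this
  have hroute := hdeal.route 𝒯 p.ρ p.σ p.σ_ρ (by
    simp only [Nat.card_prod, Nat.card_fin]
    refine le_trans ?_ hB
    have := Nat.mul_le_mul_right (n * n) hs
    nlinarith [Nat.zero_le n, Nat.zero_le (n * n), Nat.zero_le (n * n * n),
      Nat.zero_le (n * n * n * n)]) (fun G q y => p.forward hab hb G q y) (fun v G G' hh => by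
    funext y
    ext x
    rw [mem_forward, mem_forward]
    have hX : ∀ i < p.ℓ, ∀ q, p.X G q i = p.X G' q i := (hκ v G G' hh.1).1.2.1
    rw [hX a (hab.trans hb), hX b hb]
    refine and_congr_left fun _ => ?_
    have hcl := hclass v G G' hh.2
    constructor
    · rintro ⟨h1, h2, h3⟩
      have := (hcl _ h3 h2 x.1 x.2).1 ⟨h1, rfl⟩
      rw [this.2]
      exact ⟨this.1, h2, h3⟩
    · rintro ⟨h1, h2, h3⟩
      have := (hcl _ h3 h2 x.1 x.2).2 ⟨h1, rfl⟩
      rw [this.2]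
      exact ⟨this.1, h2, h3⟩) p.N p.R' p.N_lt p.Sparse
    (fun G _ q => (p.sum_card_forward_le hab hb q).trans p.R_le)
    (fun G _ q => p.sum_card_forward_move_le hab hb hpair q)
  rw [show T + (p.R + 2 + 2 * p.R') = T + p.R + 2 + 2 * p.R' by ring]
  refine hroute.mono fun v G G' hh => ⟨hh.1.1, fun hG hG' x y => ?_⟩
  have key : ∀ G, p.Sparse G →
      ((∃ z, (x, y) ∈ p.forward hab hb G (𝒯.move (𝒯.d v) z) (𝒯.idx (𝒯.d v))) ↔
      G.Adj x y ∧ x ∈ p.X G (p.d v) a ∧ y ∈ p.X G (p.d v) b) := by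
    intro G hG
    simp only [mem_forward, ← h𝒯, Teams.move_move, Teams.move_idx, Teams.idx_move]
    constructor
    · rintro ⟨z, h1, h2⟩
      exact ⟨h1.1, h2⟩
    · rintro ⟨h1, h2⟩
      exact ⟨_, ⟨h1, rfl, (edgePos_lt_sum h1).trans_le hG⟩, h2⟩
  rw [← key G hG, ← key G' hG']
  exact hh.2 hG hG' (x, y)

end

end Params

end CongestedClique

/-! ### Detection and choice of parameters -/

namespace CongestedClique

theorem HasCycleOfLength.mono {V : Type*} {G G' : SimpleGraph V} {ℓ : ℕ} (h : G ≤ G')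
    (hG : HasCycleOfLength G ℓ) : HasCycleOfLength G' ℓ := by
  obtain ⟨v, w, hw, hl⟩ := hG
  exact ⟨v, w.mapLe h, hw.mapLe h, by simpa using hl⟩

namespace Params

variable {n B T : ℕ} (p : Params n)

/-- The pairs of cyclically consecutive places in a sequence of blocks. -/
def IsPair (a b : ℕ) : Prop := a < b ∧ b < p.ℓ ∧ (b = a + 1 ∨ a = 0 ∧ b + 1 = p.ℓ)

theorem attains_knowsPairs (hB : (n + 1) ^ 4 ≤ 2 ^ B) (hs : p.s * p.s ≤ n) (hℓ : 2 ≤ p.ℓ)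
    {κ : Fin n → SimpleGraph (Fin n) → SimpleGraph (Fin n) → Prop} (h : Attains n B T κ)
    (hκ : ∀ v G G', κ v G G' → p.KnowsParts p.ℓ v G G' ∧ KnowsShare v G G') :
    Attains n B (T + p.ℓ * (p.R + 2 + 2 * p.R')) fun v G G' =>
      κ v G G' ∧ ∀ a b, p.IsPair a b → p.KnowsPair a b v G G' := by
  have path : ∀ m, m + 1 ≤ p.ℓ → Attains n B (T + m * (p.R + 2 + 2 * p.R')) fun v G G' =>
      κ v G G' ∧ ∀ a < m, p.KnowsPair a (a + 1) v G G' := by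
    intro m
    induction m with
    | zero => exact fun _ => by simpa using h
    | succ m ih =>
      intro hm
      have := p.attains_knowsPair (Nat.lt_succ_self m) hm hB hs (Or.inl rfl) (ih (by omega))
        fun v G G' hh => hκ v G G' hh.1
      rw [add_one_mul, ← add_assoc]
      refine this.mono fun v G G' hh => ⟨hh.1.1, fun a ha => ?_⟩
      rcases Nat.lt_succ_iff_lt_or_eq.mp ha with ha | rfl
      · exact hh.1.2 a ha
      · exact hh.2
  obtain ⟨m, hm⟩ : ∃ m, p.ℓ = m + 1 := ⟨p.ℓ - 1, by omega⟩
  have := p.attains_knowsPair (a := 0) (b := m) (by omega) (by omega) hB hs (Or.inr rfl)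
    (path m (by omega)) fun v G G' hh => hκ v G G' hh.1
  conv in p.ℓ * _ => rw [hm, add_one_mul]
  rw [← add_assoc]
  refine this.mono fun v G G' hh => ⟨hh.1.1, ?_⟩
  rintro a b ⟨hab, hb, rfl | ⟨rfl, h2⟩⟩
  · exact hh.1.2 a (by omega)
  · obtain rfl : b = m := by omega
    exact hh.2

/-- The edges of `G` between cyclically consecutive sets of the sequence `q`. -/
def localGraph (G : SimpleGraph (Fin n)) (q : Fin p.ℓ → Fin p.s) : SimpleGraph (Fin n) :=
  SimpleGraph.fromRel fun x y => ∃ a b, p.IsPair a b ∧ G.Adj x y ∧ x ∈ p.X G q a ∧ y ∈ p.X G q b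

theorem localGraph_le (G : SimpleGraph (Fin n)) (q : Fin p.ℓ → Fin p.s) :
    p.localGraph G q ≤ G := by
  intro x y h
  rw [localGraph, SimpleGraph.fromRel_adj] at h
  obtain ⟨-, ⟨_, _, _, h, _⟩ | ⟨_, _, _, h, _⟩⟩ := h
  · exact h
  · exact h.symm

theorem exists_hasCycleOfLength_localGraph {G : SimpleGraph (Fin n)} (hG : p.Sparse G)
    (hℓ : 2 ≤ p.ℓ) (h : HasCycleOfLength G p.ℓ) :
    ∃ q, HasCycleOfLength (p.localGraph G q) p.ℓ := by
  obtain ⟨v, w, hw, hl⟩ := h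
  obtain ⟨σ, hσ⟩ := exists_mem_part p.s_pos p.M_pos p.le_D hG w.getVert p.ℓ
  let q : Fin p.ℓ → Fin p.s := fun i => ⟨σ i, (hσ i i.2).1⟩
  have hX : ∀ i < p.ℓ, w.getVert i ∈ p.X G q i := by
    intro i hi
    rw [X, part_congr (σ' := σ) fun j hj => by simp [seq, q, show j < p.ℓ by omega]]
    exact (hσ i hi).2
  have hadj : ∀ i < p.ℓ, (p.localGraph G q).Adj (w.getVert i) (w.getVert (i + 1)) := by
    intro i hi
    have hGadj := w.adj_getVert_succ (hl.symm ▸ hi)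
    rw [localGraph, SimpleGraph.fromRel_adj]
    refine ⟨hGadj.ne, ?_⟩
    by_cases hi' : i + 1 < p.ℓ
    · exact Or.inl ⟨i, i + 1, ⟨by omega, hi', Or.inl rfl⟩, hGadj, hX i hi, hX _ hi'⟩
    · have hlast : w.getVert (i + 1) = w.getVert 0 := by
        rw [show i + 1 = w.length by omega, w.getVert_length, w.getVert_zero]
      rw [hlast] at hGadj ⊢
      -- The closing edge is recorded from the first place to the last, against the direction of the
      -- walk.
      exact Or.inr ⟨0, i, ⟨by omega, hi, Or.inr ⟨rfl, by omega⟩⟩, hGadj.symm,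
        hX 0 (by omega), hX i hi⟩
  have hedges : ∀ e ∈ w.edges, e ∈ (p.localGraph G q).edgeSet := by
    intro e
    induction e using Sym2.ind with
    | _ x y =>
      intro he
      obtain ⟨i, hi, e⟩ := (w.mk_mem_edges_iff_exists).1 he
      rw [← e]
      exact hadj i (hl ▸ hi)
  exact ⟨q, v, w.transfer _ hedges, hw.transfer hedges, by simpa using hl⟩

theorem localGraph_eq {G G' : SimpleGraph (Fin n)} {v : Fin n} (hG : p.Sparse G)
    (hG' : p.Sparse G') (h : ∀ a b, p.IsPair a b → p.KnowsPair a b v G G') :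
    p.localGraph G (p.d v) = p.localGraph G' (p.d v) := by
  have : ∀ x y, (∃ a b, p.IsPair a b ∧ G.Adj x y ∧ x ∈ p.X G (p.d v) a ∧ y ∈ p.X G (p.d v) b) ↔
      ∃ a b, p.IsPair a b ∧ G'.Adj x y ∧ x ∈ p.X G' (p.d v) a ∧ y ∈ p.X G' (p.d v) b :=
    fun x y => exists_congr fun a => exists_congr fun b => and_congr_right fun hab =>
      h a b hab hG hG' x y
  ext x y
  simp only [localGraph, SimpleGraph.fromRel_adj, this]

/-- Sparsity is known from the degrees. On a sparse graph every node tests its local graph, a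
subgraph of `G`, and broadcasts one bit. -/
theorem exists_decidesIn (hB : (n + 1) ^ 4 ≤ 2 ^ B) (hs : p.s * p.s ≤ n) (hℓ : 2 ≤ p.ℓ)
    (hdense : ∀ G : SimpleGraph (Fin n), ¬ p.Sparse G → HasCycleOfLength G p.ℓ) :
    ∃ A : Algorithm n B, A.DecidesIn (fun G => HasCycleOfLength G p.ℓ)
      (1 + 2 * p.ℓ + 1 + p.ℓ * (p.R + 2 + 2 * p.R') + 1) := by
  have hsparse : ∀ {v G G'}, p.KnowsParts p.ℓ v G G' → (p.Sparse G ↔ p.Sparse G') := by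
    intro v G G' h
    simp only [Sparse, h.1.2]
  have h := (p.attains_knowsPairs hB hs hℓ
    (p.attains_knowsShare hB (p.attains_knowsParts hB p.ℓ)) fun _ _ _ h => h).exchange
    (Set.univ : Set Prop) (Set.toFinite _) (by
      rw [Set.ncard_univ, Nat.card_eq_fintype_card, Fintype.card_prop]
      refine le_trans ?_ hB
      have : 0 < n := (Nat.mul_pos p.s_pos p.s_pos).trans_le hs
      exact le_trans (show 2 ≤ n + 1 by omega) (Nat.le_self_pow (by norm_num) _))
    (fun G u _ => p.Sparse G ∧ HasCycleOfLength (p.localGraph G (p.d u)) p.ℓ)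
    (fun _ _ _ => Set.mem_univ _) (fun u G G' hh => by
      funext _
      refine propext ?_
      rw [← hsparse hh.1.1]
      refine and_congr_right fun hG => ?_
      rw [p.localGraph_eq hG ((hsparse hh.1.1).1 hG) hh.2])
  refine h.decides _ fun v G G' hh hcyc => ?_
  by_cases hG' : p.Sparse G'
  · have hG := (hsparse hh.1.1.1).2 hG'
    obtain ⟨q, hq⟩ := p.exists_hasCycleOfLength_localGraph hG hℓ hcyc
    have := hh.2 (p.e q)
    simp only [p.d_e] at this
    exact (this.mp ⟨hG, hq⟩).2.mono (p.localGraph_le _ _)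
  · exact hdense G' hG'

end Params

theorem exists_pow_le_lt_pow {n ℓ : ℕ} (hℓ : 1 ≤ ℓ) (h : 2 ^ ℓ ≤ n) :
    ∃ s, 2 ≤ s ∧ s ^ ℓ ≤ n ∧ n < (s + 1) ^ ℓ := by
  have h2 : 2 ≤ n := (Nat.le_self_pow (by omega) 2).trans h
  refine ⟨Nat.findGreatest (fun s => s ^ ℓ ≤ n) n, Nat.le_findGreatest h2 h,
    Nat.findGreatest_spec (P := fun s => s ^ ℓ ≤ n) h2 h, ?_⟩
  by_contra hlt
  rw [not_lt] at hlt
  refine Nat.findGreatest_is_greatest (P := fun s => s ^ ℓ ≤ n) (Nat.lt_succ_self _)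
    ((Nat.le_self_pow (by omega) _).trans hlt) hlt

theorem exists_decidesIn_hasCycleOfLength {n k B : ℕ} (hk : 2 ≤ k) (hn : 2 ^ (2 * k) ≤ n)
    (hB : (n + 1) ^ 4 ≤ 2 ^ B) : ∃ (A : Algorithm n B) (T : ℕ), T ≤ 2500 * k ^ 2 ∧
      A.DecidesIn (fun G => HasCycleOfLength G (2 * k)) T := by
  obtain ⟨s, hs2, hsn, hns⟩ := exists_pow_le_lt_pow (by omega) hn
  have hn0 : 0 < n := (Nat.pow_pos (by norm_num)).trans_le hn
  have hs0 : 0 < s := by omega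
  have : NeZero s := ⟨by omega⟩
  have hs4 : s ^ 4 ≤ n := (Nat.pow_le_pow_right hs0 (by omega)).trans hsn
  obtain ⟨e⟩ : Nonempty ((Fin (2 * k) → Fin s) ↪ Fin n) :=
    Function.Embedding.nonempty_of_card_le (by simpa using hsn)
  obtain ⟨ρ⟩ : Nonempty ((Fin s × Fin s) × (Fin s × Fin s) ↪ Fin n) :=
    Function.Embedding.nonempty_of_card_le (by
      simp only [Fintype.card_prod, Fintype.card_fin]
      exact le_trans (le_of_eq (by ring)) hs4)
  -- For `2 ≤ s` the edge threshold `2 * (2 * k + 1) * (5 + (s + 1) ^ 2) * n` is at most `n * s * s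
  -- * (16 * k + 8)`, whence `R`; the choices of `D`, `N` and `R'` follow from their inequalities.
  let p : Params n :=
    { s := s
      ℓ := 2 * k
      M := n * (s * s * (16 * k + 8))
      D := 3 * (n * (s * (16 * k + 8))) + n
      R := 16 * k + 8
      N := n * (9 * (16 * k + 8) + 4)
      R' := 18 * (16 * k + 8) + 9
      s_pos := hs0
      M_pos := by positivity
      M_eq := rfl
      le_D := by nlinarith
      D_le := by nlinarith
      R_le := Nat.mul_le_mul_left _ (by omega)
      N_lt := by nlinarith
      e := e
      d := Function.invFun e
      d_e := Function.leftInverse_invFun e.injective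
      ρ := ρ
      σ := Function.invFun ρ
      σ_ρ := Function.leftInverse_invFun ρ.injective }
  obtain ⟨A, hA⟩ := p.exists_decidesIn hB
    (le_trans (by rw [← sq]; exact Nat.pow_le_pow_right hs0 (by norm_num)) hs4)
    (show 2 ≤ 2 * k by omega) fun G hG => by
      refine hasCycleOfLength_of_card_edges G (q := (s + 1) ^ 2) (Nat.one_le_pow _ _ (by omega)) ?_ ?_
      · rw [Fintype.card_fin, ← pow_mul]
        exact hns
      · rw [Fintype.card_fin]
        refine lt_of_le_of_lt ?_ (not_le.1 hG)
        have : 5 + (s + 1) ^ 2 ≤ 4 * (s * s) := by nlinarith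
        have := Nat.mul_le_mul_left (n * (2 * (2 * k + 1))) this
        simp only [p]
        nlinarith
  refine ⟨A, _, ?_, hA⟩
  simp only [p]
  -- The number of rounds is `1184 * k ^ 2 + 636 * k + 3`.
  nlinarith

theorem not_hasCycleOfLength_two {V : Type*} (G : SimpleGraph V) : ¬ HasCycleOfLength G 2 := by
  rintro ⟨v, w, hw, hl⟩
  have := hw.three_le_length
  omega

end CongestedClique

theorem corollary3 :
    ∃ b C : ℕ, ∀ n k : ℕ, 1 ≤ k → (k : ℝ) ≤ Real.logb 2 (n : ℝ) / 2 →
      ∃ (A : CongestedClique.Algorithm n (b * Nat.clog 2 n)) (T : ℕ), T ≤ C * k ^ 2 ∧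
        A.DecidesIn (fun G => CongestedClique.HasCycleOfLength G (2 * k)) T := by
  refine ⟨8, 2500, fun n k hk hkn => ?_⟩
  have hn : 2 ^ (2 * k) ≤ n := by
    have hn0 : (0 : ℝ) < n := by
      rcases Nat.eq_zero_or_pos n with rfl | h
      · have : (1 : ℝ) ≤ k := by exact_mod_cast hk
        simp at hkn
        linarith
      · exact_mod_cast h
    have h : ((2 * k : ℕ) : ℝ) ≤ Real.logb 2 n := by
      push_cast
      linarith
    rw [Real.le_logb_iff_rpow_le (by norm_num) hn0, Real.rpow_natCast] at h
    exact_mod_cast h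
  have hn4 : 4 ≤ n := le_trans (show 2 ^ 2 ≤ 2 ^ (2 * k) from Nat.pow_le_pow_right (by norm_num) (by omega)) hn
  rcases hk.eq_or_lt with rfl | hk
  · exact ⟨⟨Unit, fun _ _ => (), fun _ _ _ => false, fun _ _ => (), fun _ => false⟩, 0, by simp,
      fun G v => by simp [CongestedClique.not_hasCycleOfLength_two]⟩
  · refine CongestedClique.exists_decidesIn_hasCycleOfLength hk hn ?_
    have h1 : n ≤ 2 ^ Nat.clog 2 n := Nat.le_pow_clog (by norm_num) n
    -- The message size `b = 8` comes from `n + 1 ≤ n ^ 2`.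
    calc (n + 1) ^ 4 ≤ (n ^ 2) ^ 4 := Nat.pow_le_pow_left (by nlinarith) 4
      _ = n ^ 8 := by ring
      _ ≤ (2 ^ Nat.clog 2 n) ^ 8 := Nat.pow_le_pow_left h1 8
      _ = 2 ^ (8 * Nat.clog 2 n) := by rw [← pow_mul, mul_comm]
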